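/- Let $d\ge 1$ and let $M$ be a smooth $(d+1)$-dimensional manifold (Hausdorff, second countable) with a continuous Lorentzian metric $g$ of signature $(-,+,\dots,+)$, time oriented by a continuous timelike vector field $X$; a vector $v$ is causal if $v\neq 0$ and $g(v,v)\le 0$, and a causal $v$ is future directed if $g(v,X)<0$. A classically causal curve is an absolutely continuous curve $\sigma:[0,1]\to M$ such that $\dot\sigma_t$ is zero or causal and future directed for a.e. $t$. For $x,y\in M$ let $$\ell_g(x,y)=\sup\Big\{\int_0^1\sqrt{-g(\dot\sigma_t,\dot\sigma_t)}\,dt \;:\; \sigma:[0,1]\to M \text{ Lipschitz and classically causal},\ \sigma_0=x,\ \sigma_1=y\Big\}\in\{-\infty\}\cup[0,\infty]$$ (with $\sup\emptyset=-\infty$), and write $x\le_g y$ if $\ell_g(x,y)\ge 0$. Assume that $(M,g)$ is causally simple: every closed classically causal curve is constant, and $\{(x,y): x\le_g y\}$ is closed in $M\times M$. Let $\gamma:[0,1]\to M$ be a left-continuous causal path, i.e. $\gamma_s\le_g\gamma_t$ for all $0\le s\le t\le 1$ and $\lim_{s\nearrow t}\gamma_s=\gamma_t$ for all $t\in(0,1]$.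 Then there is a largest Borel measure $\mu$ on $[0,1]$ with $\mu([s,t])\le \ell_g(\gamma_s,\gamma_t)$ for all $0\le s\le t\le 1$; it has a Lebesgue decomposition with respect to the Lebesgue measure $\mathcal L^1$, and the density of its absolutely continuous part is called the causal speed $|\dot\gamma_t|$ of $\gamma$. Moreover, for almost every $t\in[0,1]$, $\gamma$ is differentiable at $t$, $g(\dot\gamma_t,\dot\gamma_t)\le 0$, and $$|\dot\gamma_t| = |\dot\gamma_t|_g := \sqrt{-g(\dot\gamma_t,\dot\gamma_t)} .$$ -/

import Mathlib

open Set Filter Topology MeasureTheory Bundle Manifold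
open scoped ENNReal NNReal ContDiff

/-! ### Causal paths and the causal speed for an abstract time separation -/

/-- A left-continuous causal path `[0,1] → X` for the time separation `ℓ : X × X → {-∞} ∪ [0,∞]`,
where `x ≤ y` means `0 ≤ ℓ x y`. Only the values of `γ` on `[0,1]` matter. -/
structure IsLeftContinuousCausalPath {X : Type*} [TopologicalSpace X] (ℓ : X → X → EReal)
    (γ : ℝ → X) : Prop where
  causal : ∀ s t : ℝ, 0 ≤ s → s ≤ t → t ≤ 1 → 0 ≤ ℓ (γ s) (γ t)
  left_continuous : ∀ t ∈ Ioc (0 : ℝ) 1, Tendsto γ (𝓝[<] t) (𝓝 (γ t))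

/-- The Borel measures `μ` on `[0,1]` (seen as Borel measures on `ℝ` that do not charge the
complement of `[0,1]`) with `μ [s,t] ≤ ℓ (γ s) (γ t)` for all `0 ≤ s ≤ t ≤ 1`. -/
def speedMinorants {X : Type*} (ℓ : X → X → EReal) (γ : ℝ → X) : Set (Measure ℝ) :=
  {μ | μ (Icc (0 : ℝ) 1)ᶜ = 0 ∧
    ∀ s t : ℝ, 0 ≤ s → s ≤ t → t ≤ 1 → ((μ (Icc s t) : ℝ≥0∞) : EReal) ≤ ℓ (γ s) (γ t)}

/-- The maximal Borel measure `μ` on `[0,1]` with `μ [s,t] ≤ ℓ (γ s) (γ t)` for all `s ≤ t`,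
as the supremum, in the complete lattice of measures, of all the measures with this property. -/
noncomputable def causalSpeedMeasure {X : Type*} (ℓ : X → X → EReal) (γ : ℝ → X) : Measure ℝ :=
  sSup (speedMinorants ℓ γ)

/-- The causal speed: the density of the absolutely continuous part in the Lebesgue decomposition
of the maximal measure with respect to the Lebesgue measure. -/
noncomputable def causalSpeed {X : Type*} (ℓ : X → X → EReal) (γ : ℝ → X) (t : ℝ) : ℝ≥0∞ :=
  (causalSpeedMeasure ℓ γ).rnDeriv volume t

/-! ### Curves in a manifold -/

section Curves

variable {d : ℕ} {M : Type*} [TopologicalSpace M]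
  [ChartedSpace (EuclideanSpace ℝ (Fin (d + 1))) M]

/-- The derivative `γ̇_t ∈ T_{γ t} M` of a path `γ : [0,1] → M` (one-sided at `t = 0` and `t = 1`);
it is the zero vector where `γ` is not differentiable. -/
noncomputable def velocity (γ : ℝ → M) (t : ℝ) : TangentSpace (𝓡 (d + 1)) (γ t) :=
  mfderivWithin 𝓘(ℝ, ℝ) (𝓡 (d + 1)) γ (Icc (0 : ℝ) 1) t (1 : ℝ)

variable (d)

/-- `γ : [0,1] → M` is absolutely continuous: it is so in charts, near every time. -/
def IsAbsolutelyContinuousCurve (γ : ℝ → M) : Prop :=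
  ContinuousOn γ (Icc (0 : ℝ) 1) ∧
    ∀ t ∈ Icc (0 : ℝ) 1, ∃ a b : ℝ, a < b ∧ Icc a b ⊆ Icc (0 : ℝ) 1 ∧
      Icc a b ∈ 𝓝[Icc (0 : ℝ) 1] t ∧ MapsTo γ (Icc a b) (extChartAt (𝓡 (d + 1)) (γ t)).source ∧
      AbsolutelyContinuousOnInterval (extChartAt (𝓡 (d + 1)) (γ t) ∘ γ) a b

/-- `γ ∈ C^{0,1}([0,1], M)`: the path is Lipschitz in charts, near every time. As `[0,1]` is compact
and the distance of a Riemannian metric is locally bi-Lipschitz to the Euclidean distance of a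
chart, this is the Lipschitz property for the distance of any Riemannian metric. -/
def IsLipschitzCurve (γ : ℝ → M) : Prop :=
  ContinuousOn γ (Icc (0 : ℝ) 1) ∧
    ∀ t ∈ Icc (0 : ℝ) 1, ∃ K : ℝ≥0, ∃ U ∈ 𝓝[Icc (0 : ℝ) 1] t,
      MapsTo γ U (extChartAt (𝓡 (d + 1)) (γ t)).source ∧
      LipschitzOnWith K (extChartAt (𝓡 (d + 1)) (γ t) ∘ γ) U

end Curves

/-! ### Spacetimes with a continuous Lorentzian metric -/

/-- A `(d+1)`-dimensional smooth manifold `M` with a continuous Lorentzian metric of signature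
`(-,+,…,+)`, time oriented by a continuous timelike vector field. -/
structure ContinuousSpacetime (d : ℕ) (M : Type*) [TopologicalSpace M]
    [ChartedSpace (EuclideanSpace ℝ (Fin (d + 1))) M] [IsManifold (𝓡 (d + 1)) ∞ M] where
  /-- the metric `g` -/
  g : ∀ x : M, TangentSpace (𝓡 (d + 1)) x →L[ℝ] TangentSpace (𝓡 (d + 1)) x →L[ℝ] ℝ
  symm : ∀ (x : M) (v w : TangentSpace (𝓡 (d + 1)) x), g x v w = g x w v
  signature : ∀ x : M, ∃ b : Module.Basis (Fin (d + 1)) ℝ (TangentSpace (𝓡 (d + 1)) x),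
    ∀ i j, g x (b i) (b j) = if i = j then (if i = 0 then -1 else 1) else 0
  continuous_g : Continuous fun x : M ↦
    TotalSpace.mk' (EuclideanSpace ℝ (Fin (d + 1)) →L[ℝ] EuclideanSpace ℝ (Fin (d + 1)) →L[ℝ] ℝ)
      (E := fun x : M ↦
        TangentSpace (𝓡 (d + 1)) x →L[ℝ] TangentSpace (𝓡 (d + 1)) x →L[ℝ] ℝ) x (g x)
  /-- the vector field `X` that singles out the future cones -/
  timeField : ∀ x : M, TangentSpace (𝓡 (d + 1)) x
  timelike_timeField : ∀ x : M, g x (timeField x) (timeField x) < 0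
  continuous_timeField : Continuous fun x : M ↦ (⟨x, timeField x⟩ : TangentBundle (𝓡 (d + 1)) M)

namespace ContinuousSpacetime

variable {d : ℕ} {M : Type*} [TopologicalSpace M]
  [ChartedSpace (EuclideanSpace ℝ (Fin (d + 1))) M] [IsManifold (𝓡 (d + 1)) ∞ M]
  (S : ContinuousSpacetime d M)

/-- Causal vectors: timelike or null (null vectors being non-zero). -/
def IsCausalVector {x : M} (v : TangentSpace (𝓡 (d + 1)) x) : Prop :=
  S.g x v v < 0 ∨ (S.g x v v = 0 ∧ v ≠ 0)

/-- Future directed causal vectors. -/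
def IsFutureDirected {x : M} (v : TangentSpace (𝓡 (d + 1)) x) : Prop :=
  S.IsCausalVector v ∧ S.g x v (S.timeField x) < 0

/-- `|v|_g = √(-g(v,v))`, meaningful if `g(v,v) ≤ 0`. -/
noncomputable def lorentzNorm {x : M} (v : TangentSpace (𝓡 (d + 1)) x) : ℝ :=
  √(-(S.g x v v))

/-- Classically causal, future directed curves `[0,1] → M`: absolutely continuous curves with
`γ̇_t` zero or causal and future directed for almost every `t`. -/
def IsClassicallyCausal (γ : ℝ → M) : Prop :=
  IsAbsolutelyContinuousCurve d γ ∧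
    ∀ᵐ t ∂(volume.restrict (Icc (0 : ℝ) 1)),
      velocity (d := d) γ t = 0 ∨ S.IsFutureDirected (velocity (d := d) γ t)

/-- `L_g(γ) = ∫₀¹ √(-g(γ̇_t, γ̇_t)) dt`. -/
noncomputable def length (γ : ℝ → M) : ℝ≥0∞ :=
  ∫⁻ t in Icc (0 : ℝ) 1, ENNReal.ofReal (S.lorentzNorm (velocity (d := d) γ t))

/-- The time separation `ℓ_g`: the supremum of the lengths of the Lipschitz classically causal
future directed curves from `x` to `y`, which is `-∞` if there are none. -/
noncomputable def timeSeparation (x y : M) : EReal :=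
  sSup {L : EReal | ∃ γ : ℝ → M, IsLipschitzCurve d γ ∧ S.IsClassicallyCausal γ ∧
    γ 0 = x ∧ γ 1 = y ∧ L = ((S.length γ : ℝ≥0∞) : EReal)}

/-- Causal simplicity: no non-constant closed classically causal curve, and `≤_g` is closed. -/
def CausallySimple : Prop :=
  (∀ γ : ℝ → M, S.IsClassicallyCausal γ → γ 0 = γ 1 → ∀ t ∈ Icc (0 : ℝ) 1, γ t = γ 0) ∧
    IsClosed {p : M × M | 0 ≤ S.timeSeparation p.1 p.2}

end ContinuousSpacetime

/-! Put `L s t = ℓ (γ s) (γ t)`. Concatenation of curves gives the reverse triangle inequality, so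
`L` is superadditive on intervals. The largest measure below such an `L` comes from a Carathéodory
construction: charge a small set the value of `L` at its hull and let the mesh tend to zero. Every
minorant lies below the result, and superadditivity keeps the result below `L`
(`greatestMinorant_isGreatest`).

The analytic core is `rnDeriv_greatestMinorant`: if for almost every `x` the means `L s t / (t - s)`
converge to `F x` as intervals containing `x` shrink to `x`, then `F` is the density. The bound from
above is Besicovitch differentiation. For the bound from below, `F` is a limit of step functions
whose integrals superadditivity controls, so by Fatou `F` is the density of a minorant.

It remains to show that `γ` is differentiable almost everywhere and that the means converge to
`|γ̇|_g`. Causal simplicity confines causal curves between nearby points to one chart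
(`eventually_causalCurve_mapsTo`), where the metric is close to a constant Lorentzian form `B`. The
nearby cones lie inside a half space, away from its boundary, so displacements are bounded by
increments of a linear time function (`exists_norm_sub_le`); on a left neighbourhood of each time
`γ` is then a Lipschitz function of a monotone function, hence differentiable almost everywhere.

Let `w` be the derivative in the chart and `D` the upper limit of the means. Integrating the reverse
Cauchy-Schwarz inequality along causal curves gives `D |u| ≤ -B u w` for every future timelike `u`,
and these inequalities together force `w` to be causal or zero with `D ≤ |w|`
(`le_sqrt_of_forall_timelike`). Conversely, if `w` is timelike, coordinate segments in directions
near `w` are causal curves of almost the right length (`eventually_le_timeSeparation`), so the lower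
limit is at least `|w|`; if `B w w = 0` there is nothing to prove. -/

/-! ### The largest measure below a superadditive function of intervals -/

/-- Superadditivity on `[0,1]` of a function of intervals. -/
def IntervalSuperadditive (L : ℝ → ℝ → ℝ≥0∞) : Prop :=
  ∀ r s t : ℝ, 0 ≤ r → r ≤ s → s ≤ t → t ≤ 1 → L r s + L s t ≤ L r t

/-- The Borel measures on `[0,1]` that are bounded on intervals by `L`. -/
def intervalMinorants (L : ℝ → ℝ → ℝ≥0∞) : Set (Measure ℝ) :=
  {μ | μ (Icc (0 : ℝ) 1)ᶜ = 0 ∧ ∀ s t : ℝ, 0 ≤ s → s ≤ t → t ≤ 1 → μ (Icc s t) ≤ L s t}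

open Classical in
/-- The value of `L` at the smallest interval that contains the part of `E` in `[0,1]`. -/
noncomputable def hullValue (L : ℝ → ℝ → ℝ≥0∞) (E : Set ℝ) : ℝ≥0∞ :=
  if (E ∩ Icc 0 1).Nonempty then L (sInf (E ∩ Icc 0 1)) (sSup (E ∩ Icc 0 1)) else 0

/-- The largest Borel measure on `[0,1]` bounded on intervals by `L`. -/
noncomputable def greatestMinorant (L : ℝ → ℝ → ℝ≥0∞) : Measure ℝ :=
  (Measure.mkMetric' (hullValue L)).restrict (Icc 0 1)

/-- A minorant charges only `[0,1]`, so `E` can be enlarged to the interval spanned by `E ∩ [0,1]`,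
where the bound by `L` applies. -/
lemma measure_le_hullValue {L : ℝ → ℝ → ℝ≥0∞} {ν : Measure ℝ} (hν : ν ∈ intervalMinorants L)
    (E : Set ℝ) : ν E ≤ hullValue L E := by
  have h1 : ν E ≤ ν (E ∩ Icc 0 1) := by
    calc ν E ≤ ν ((E ∩ Icc 0 1) ∪ (Icc 0 1)ᶜ) := by
          apply measure_mono
          intro x hx
          by_cases h : x ∈ Icc (0 : ℝ) 1
          · exact Or.inl ⟨hx, h⟩
          · exact Or.inr h
      _ ≤ ν (E ∩ Icc 0 1) + ν (Icc 0 1)ᶜ := measure_union_le _ _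
      _ = ν (E ∩ Icc 0 1) := by rw [hν.1, add_zero]
  refine h1.trans ?_
  unfold hullValue
  split_ifs with h
  · have hb : BddBelow (E ∩ Icc (0 : ℝ) 1) := ⟨0, fun x hx => hx.2.1⟩
    have ha : BddAbove (E ∩ Icc (0 : ℝ) 1) := ⟨1, fun x hx => hx.2.2⟩
    calc ν (E ∩ Icc 0 1) ≤ ν (Icc (sInf (E ∩ Icc 0 1)) (sSup (E ∩ Icc 0 1))) :=
          measure_mono fun x hx => ⟨csInf_le hb hx, le_csSup ha hx⟩
      _ ≤ _ := hν.2 _ _ (le_csInf h fun x hx => hx.2.1) (csInf_le_csSup h hb ha)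
          (csSup_le h fun x hx => hx.2.2)
  · rw [not_nonempty_iff_eq_empty.1 h]; simp

/-- At each mesh size the construction takes the largest outer measure bounded by `hullValue L` on
sets of that diameter, and a minorant obeys this bound on all sets. One mesh size suffices, because
the construction is a supremum over them. -/
lemma le_greatestMinorant {L : ℝ → ℝ → ℝ≥0∞} {ν : Measure ℝ} (hν : ν ∈ intervalMinorants L) :
    ν ≤ greatestMinorant L := by
  have h : ν ≤ Measure.mkMetric' (hullValue L) := by
    rw [← Measure.toOuterMeasure_le, Measure.mkMetric'_toOuterMeasure]
    refine le_trans ?_ (OuterMeasure.le_trim _)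
    refine le_trans ?_ (le_iSup₂_of_le (1 : ℝ≥0∞) one_pos le_rfl)
    exact OuterMeasure.mkMetric'.le_pre.2 fun s _ => measure_le_hullValue hν s
  calc ν = ν.restrict (Icc 0 1) := by
        refine (Measure.restrict_eq_self_of_ae_mem ?_).symm
        exact hν.1
    _ ≤ _ := Measure.restrict_mono le_rfl h

lemma IntervalSuperadditive.sum_le {L : ℝ → ℝ → ℝ≥0∞} (hL : IntervalSuperadditive L) {u : ℕ → ℝ}
    (hu : Monotone u) (h0 : 0 ≤ u 0) (n : ℕ) (hn : u (n + 1) ≤ 1) :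
    ∑ i ∈ Finset.range (n + 1), L (u i) (u (i + 1)) ≤ L (u 0) (u (n + 1)) := by
  induction n with
  | zero => simp
  | succ n ih =>
    rw [Finset.sum_range_succ]
    have h1 : u (n + 1) ≤ u (n + 1 + 1) := hu (Nat.le_succ _)
    exact (add_le_add (ih (h1.trans hn)) le_rfl).trans
      (hL _ _ _ h0 (hu (Nat.zero_le _)) h1 hn)

lemma hullValue_Icc (L : ℝ → ℝ → ℝ≥0∞) {s t : ℝ} (h0 : 0 ≤ s) (hst : s ≤ t) (h1 : t ≤ 1) :
    hullValue L (Icc s t) = L s t := by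
  have : Icc s t ∩ Icc 0 1 = Icc s t := inter_eq_left.2 (Icc_subset_Icc h0 h1)
  unfold hullValue
  rw [this, if_pos (nonempty_Icc.2 hst), csInf_Icc hst, csSup_Icc hst]

/-- The points of the partition of `[s,t]` into `n + 1` intervals of equal length. -/
noncomputable def partitionPoint (s t : ℝ) (n i : ℕ) : ℝ := s + i * ((t - s) / (n + 1))

lemma partitionPoint_zero (s t : ℝ) (n : ℕ) : partitionPoint s t n 0 = s := by
  simp [partitionPoint]

lemma partitionPoint_last (s t : ℝ) (n : ℕ) : partitionPoint s t n (n + 1) = t := by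
  have : (n : ℝ) + 1 ≠ 0 := by positivity
  simp only [partitionPoint]; push_cast; field_simp; ring

lemma partitionPoint_succ (s t : ℝ) (n i : ℕ) :
    partitionPoint s t n (i + 1) = partitionPoint s t n i + (t - s) / (n + 1) := by
  simp only [partitionPoint]; push_cast; ring

lemma partitionPoint_mono {s t : ℝ} (h : s ≤ t) (n : ℕ) : Monotone (partitionPoint s t n) := by
  refine monotone_nat_of_le_succ fun i => ?_
  rw [partitionPoint_succ]
  have : 0 ≤ (t - s) / ((n : ℝ) + 1) := div_nonneg (by linarith) (by positivity)
  linarith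

lemma iUnion_Ioc_of_monotone {u : ℕ → ℝ} (hu : Monotone u) (n : ℕ) :
    (⋃ i ∈ Finset.range n, Ioc (u i) (u (i + 1))) = Ioc (u 0) (u n) := by
  induction n with
  | zero => simp
  | succ n ih =>
    rw [Finset.range_add_one, Finset.set_biUnion_insert, ih, union_comm,
      Ioc_union_Ioc_eq_Ioc (hu (Nat.zero_le _)) (hu (Nat.le_succ _))]

/-- For each mesh `r`, cover `[s,t]` by equal cells of length at most `r` and charge each cell its
value of `L`. Superadditivity bounds the sum by `L s t`, independently of `r`. -/
lemma greatestMinorant_Icc_le {L : ℝ → ℝ → ℝ≥0∞} (hL : IntervalSuperadditive L) {s t : ℝ}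
    (h0 : 0 ≤ s) (hst : s ≤ t) (h1 : t ≤ 1) : greatestMinorant L (Icc s t) ≤ L s t := by
  refine (Measure.restrict_apply_le _ _).trans ?_
  rw [← Measure.coe_toOuterMeasure, Measure.mkMetric'_toOuterMeasure,
    OuterMeasure.trim_eq _ measurableSet_Icc]
  rcases hst.eq_or_lt with rfl | hlt
  · refine le_trans ?_ (hullValue_Icc L h0 le_rfl h1).le
    simp only [OuterMeasure.mkMetric', OuterMeasure.iSup_apply]
    refine iSup₂_le fun r hr => OuterMeasure.mkMetric'.pre_le ?_
    simp
  simp only [OuterMeasure.mkMetric', OuterMeasure.iSup_apply]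
  refine iSup₂_le fun r hr => ?_
  obtain ⟨n, hn⟩ : ∃ n : ℕ, ENNReal.ofReal ((t - s) / ((n : ℝ) + 1)) ≤ r := by
    have h : Tendsto (fun n : ℕ => ENNReal.ofReal ((t - s) / ((n : ℝ) + 1))) atTop (𝓝 0) := by
      rw [← ENNReal.ofReal_zero]
      refine (ENNReal.continuous_ofReal.tendsto _).comp ?_
      have := (tendsto_one_div_add_atTop_nhds_zero_nat (𝕜 := ℝ)).const_mul (t - s)
      simpa [div_eq_mul_inv] using this
    exact ((h.eventually (gt_mem_nhds hr)).mono fun _ h => h.le).exists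
  set u := partitionPoint s t n with hu
  have hmono : Monotone u := partitionPoint_mono hst n
  have hcov : Icc s t ⊆ ⋃ i ∈ Finset.range (n + 1), Icc (u i) (u (i + 1)) := by
    intro x hx
    rcases hx.1.eq_or_lt with rfl | hx1
    · refine mem_iUnion₂.2 ⟨0, by simp, ?_⟩
      rw [hu, partitionPoint_zero]
      exact ⟨le_rfl, by simpa [partitionPoint_zero] using partitionPoint_mono hst n (Nat.zero_le 1)⟩
    · have : x ∈ Ioc (u 0) (u (n + 1)) := by
        rw [hu, partitionPoint_zero, partitionPoint_last]; exact ⟨hx1, hx.2⟩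
      rw [← iUnion_Ioc_of_monotone hmono] at this
      obtain ⟨i, hi, hi'⟩ := mem_iUnion₂.1 this
      exact mem_iUnion₂.2 ⟨i, hi, Ioc_subset_Icc_self hi'⟩
  have hlast : u (n + 1) ≤ 1 := by rw [hu, partitionPoint_last]; exact h1
  have hfirst : 0 ≤ u 0 := by rw [hu, partitionPoint_zero]; exact h0
  calc OuterMeasure.mkMetric'.pre (hullValue L) r (Icc s t)
      ≤ OuterMeasure.mkMetric'.pre (hullValue L) r (⋃ i ∈ Finset.range (n + 1), Icc (u i) (u (i + 1))) :=
        measure_mono hcov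
    _ ≤ ∑ i ∈ Finset.range (n + 1), OuterMeasure.mkMetric'.pre (hullValue L) r (Icc (u i) (u (i + 1))) :=
        measure_biUnion_finset_le _ _
    _ ≤ ∑ i ∈ Finset.range (n + 1), L (u i) (u (i + 1)) := by
        refine Finset.sum_le_sum fun i hi => ?_
        have hi1 : i + 1 ≤ n + 1 := by simpa using hi
        rw [← hullValue_Icc L (hfirst.trans (hmono (Nat.zero_le i))) (hmono (Nat.le_succ i))
          ((hmono hi1).trans hlast)]
        refine OuterMeasure.mkMetric'.pre_le ?_
        rw [Real.ediam_Icc]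
        refine le_trans (le_of_eq ?_) hn
        rw [hu, partitionPoint_succ]; ring_nf
    _ ≤ L (u 0) (u (n + 1)) := hL.sum_le hmono hfirst n hlast
    _ = L s t := by rw [hu, partitionPoint_zero, partitionPoint_last]

lemma greatestMinorant_isGreatest {L : ℝ → ℝ → ℝ≥0∞} (hL : IntervalSuperadditive L) :
    IsGreatest (intervalMinorants L) (greatestMinorant L) := by
  refine ⟨⟨?_, fun s t h0 hst h1 => greatestMinorant_Icc_le hL h0 hst h1⟩,
    fun ν hν => le_greatestMinorant hν⟩
  rw [greatestMinorant, Measure.restrict_apply measurableSet_Icc.compl]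
  simp

/-! ### Coverings by left neighbourhoods -/

/-- A family of left neighbourhoods of all points of a set has a countable subcover. -/
lemma exists_countable_cover_Ioc {s : Set ℝ} {a : ℝ → ℝ} (ha : ∀ t ∈ s, a t < t) :
    ∃ T ⊆ s, T.Countable ∧ s ⊆ ⋃ t ∈ T, Ioc (a t) t := by
  -- By Lindelöf, countably many of the open intervals cover every point interior to one of them;
  -- only the points of `R` can be missed.
  obtain ⟨T, hTc, hT⟩ := TopologicalSpace.isOpen_iUnion_countable
    (fun t : s => Ioo (a t) (t : ℝ)) fun _ => isOpen_Ioo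
  set R : Set ℝ := {t ∈ s | ∀ t' ∈ s, t ∉ Ioo (a t') t'} with hR
  have hRc : R.Countable := by
    -- If the intervals of `u < v` in `R` met, then `a v < u < v`, against `u ∈ R`. The reflection
    -- turns left intervals into the right intervals of the countability criterion.
    have hd : (Neg.neg '' R).PairwiseDisjoint fun x => Ioo x (-(a (-x))) := by
      rintro _ ⟨u, us, rfl⟩ _ ⟨v, vs, rfl⟩ huv
      wlog hle : u < v generalizing u v
      · refine (this v vs u us huv.symm (lt_of_le_of_ne (not_lt.1 hle) ?_)).symm
        rintro rfl; exact huv rfl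
      refine disjoint_left.2 fun x hx hx' => us.2 v vs.1 ⟨?_, hle⟩
      simp only [neg_neg, mem_Ioo] at hx hx'
      linarith [hx.1, hx'.2]
    have := hd.countable_of_Ioo (by
      rintro _ ⟨u, us, rfl⟩
      simpa using ha u us.1)
    simpa using (this.image Neg.neg)
  refine ⟨(↑) '' T ∪ R, ?_, (hTc.image _).union hRc, fun x hx => ?_⟩
  · rintro x (⟨y, -, rfl⟩ | hx)
    exacts [y.2, hx.1]
  · by_cases h : x ∈ R
    · exact mem_iUnion₂.2 ⟨x, Or.inr h, ha x hx, le_rfl⟩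
    · have : ∃ t' ∈ s, x ∈ Ioo (a t') t' := by
        by_contra! h'
        exact h ⟨hx, h'⟩
      obtain ⟨t', ht', hxt⟩ := this
      have : x ∈ ⋃ t : s, Ioo (a t) (t : ℝ) := mem_iUnion.2 ⟨⟨t', ht'⟩, hxt⟩
      rw [← hT] at this
      obtain ⟨i, hi, hi'⟩ := mem_iUnion₂.1 this
      exact mem_iUnion₂.2 ⟨i, Or.inl ⟨i, hi, rfl⟩, Ioo_subset_Ioc_self hi'⟩

/-- A property that holds almost everywhere on a left neighbourhood of every point of `(0,1]`
holds almost everywhere on `[0,1]`. -/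
lemma ae_restrict_Icc_of_forall_left {P : ℝ → Prop}
    (h : ∀ t ∈ Ioc (0 : ℝ) 1, ∃ a < t, ∀ᵐ x, x ∈ Ioo a t → P x) :
    ∀ᵐ x ∂(volume.restrict (Icc (0 : ℝ) 1)), P x := by
  choose! a ha hP using h
  obtain ⟨T, hTs, hTc, hT⟩ := exists_countable_cover_Ioc ha
  rw [ae_restrict_iff' measurableSet_Icc]
  have h1 : ∀ᵐ x, ∀ t ∈ T, x ∈ Ioo (a t) t → P x := (ae_ball_iff hTc).2 fun t ht => hP t (hTs ht)
  have h2 : ∀ᵐ x : ℝ, x ∉ T := hTc.ae_notMem volume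
  have h3 : ∀ᵐ x : ℝ, x ≠ 0 := by simp [ae_iff]
  filter_upwards [h1, h2, h3] with x hx1 hx2 hx3 hx
  obtain ⟨t, ht, hxt⟩ := mem_iUnion₂.1 (hT ⟨lt_of_le_of_ne hx.1 hx3.symm, hx.2⟩)
  exact hx1 t ht ⟨hxt.1, lt_of_le_of_ne hxt.2 fun h => hx2 (h ▸ ht)⟩

/-- Mass is controlled only to the left of each point, so local finiteness may fail; a countable
cover by left neighbourhoods still gives σ-finiteness. The point `0` has no left neighbourhood in
`[0,1]` and needs its own bound. -/
lemma sigmaFinite_of_forall_left {μ : Measure ℝ} (h01 : μ (Icc (0 : ℝ) 1)ᶜ = 0) (h0 : μ {0} < ⊤)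
    (h : ∀ t ∈ Ioc (0 : ℝ) 1, ∃ a < t, μ (Ioc a t) < ⊤) : SigmaFinite μ := by
  choose! a ha hfin using h
  obtain ⟨T, hTs, hTc, hT⟩ := exists_countable_cover_Ioc ha
  refine Measure.sigmaFinite_of_countable (S := {(Icc (0 : ℝ) 1)ᶜ, {0}} ∪ (fun t => Ioc (a t) t) '' T)
    ((by simp : ({(Icc (0 : ℝ) 1)ᶜ, {0}} : Set (Set ℝ)).Countable).union (hTc.image _)) ?_ ?_
  · rintro s ((rfl | rfl) | ⟨t, ht, rfl⟩)
    exacts [h01 ▸ ENNReal.zero_lt_top, h0, hfin t (hTs ht)]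
  · refine eq_univ_of_forall fun x => ?_
    by_cases hx : x ∈ Icc (0 : ℝ) 1
    · by_cases hx0 : x = 0
      · exact ⟨{0}, Or.inl (by simp), hx0⟩
      · obtain ⟨t, ht, hxt⟩ := mem_iUnion₂.1 (hT ⟨lt_of_le_of_ne hx.1 (Ne.symm hx0), hx.2⟩)
        exact ⟨_, Or.inr ⟨t, ht, rfl⟩, hxt⟩
    · exact ⟨(Icc (0 : ℝ) 1)ᶜ, Or.inl (by simp), hx⟩

/-! ### The density of the largest minorant -/

/-- Nondegenerate intervals `[s,s']` that contain `t` and shrink to `t`. -/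
def straddleFilter (t : ℝ) : Filter (ℝ × ℝ) :=
  𝓝 (t, t) ⊓ 𝓟 {p | p.1 < p.2 ∧ p.1 ≤ t ∧ t ≤ p.2}

lemma tendsto_straddleFilter {ι : Type*} {l : Filter ι} {t : ℝ} {p : ι → ℝ × ℝ} {δ : ι → ℝ}
    (hδ : Tendsto δ l (𝓝 0)) (h : ∀ᶠ i in l, (p i).1 < (p i).2 ∧ (p i).1 ≤ t ∧ t ≤ (p i).2 ∧
      (p i).2 - (p i).1 ≤ δ i) : Tendsto p l (straddleFilter t) := by
  refine tendsto_inf.2 ⟨?_, tendsto_principal.2 (h.mono fun i hi => ⟨hi.1, hi.2.1, hi.2.2.1⟩)⟩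
  have h1 : Tendsto (fun i => t - δ i) l (𝓝 t) := by simpa using hδ.const_sub t
  have h2 : Tendsto (fun i => t + δ i) l (𝓝 t) := by simpa using hδ.const_add t
  refine Tendsto.prodMk_nhds (f := l) (mx := fun i => (p i).1) (my := fun i => (p i).2) ?_ ?_
  · exact tendsto_of_tendsto_of_tendsto_of_le_of_le' h1 tendsto_const_nhds
      (h.mono fun i hi => by linarith) (h.mono fun i hi => hi.2.1)
  · exact tendsto_of_tendsto_of_tendsto_of_le_of_le' tendsto_const_nhds h2
      (h.mono fun i hi => hi.2.2.1) (h.mono fun i hi => by linarith)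

/-- The mean value of `L` on the intervals of a partition of `[s,t]`. -/
noncomputable def partitionDensity (L : ℝ → ℝ → ℝ≥0∞) (s t : ℝ) (n : ℕ) (x : ℝ) : ℝ≥0∞ :=
  ∑ i ∈ Finset.range (n + 1),
    (Ioc (partitionPoint s t n i) (partitionPoint s t n (i + 1))).indicator
      (fun _ => L (partitionPoint s t n i) (partitionPoint s t n (i + 1)) /
        ENNReal.ofReal ((t - s) / (n + 1))) x

lemma measurable_partitionDensity (L : ℝ → ℝ → ℝ≥0∞) (s t : ℝ) (n : ℕ) :
    Measurable (partitionDensity L s t n) :=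
  Finset.measurable_fun_sum _ fun _ _ => measurable_const.indicator measurableSet_Ioc

lemma lintegral_partitionDensity_le {L : ℝ → ℝ → ℝ≥0∞} (hL : IntervalSuperadditive L) {s t : ℝ}
    (h0 : 0 ≤ s) (hst : s < t) (h1 : t ≤ 1) (n : ℕ) :
    ∫⁻ x, partitionDensity L s t n x ≤ L s t := by
  unfold partitionDensity
  rw [lintegral_finsetSum _ fun _ _ => measurable_const.indicator measurableSet_Ioc]
  have hpos : 0 < (t - s) / ((n : ℝ) + 1) := div_pos (by linarith) (by positivity)
  calc _ = ∑ i ∈ Finset.range (n + 1),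
        L (partitionPoint s t n i) (partitionPoint s t n (i + 1)) := by
        refine Finset.sum_congr rfl fun i _ => ?_
        rw [lintegral_indicator measurableSet_Ioc, setLIntegral_const, Real.volume_Ioc,
          partitionPoint_succ, add_sub_cancel_left, ENNReal.div_mul_cancel]
        · exact (ENNReal.ofReal_pos.2 hpos).ne'
        · exact ENNReal.ofReal_ne_top
    _ ≤ L (partitionPoint s t n 0) (partitionPoint s t n (n + 1)) :=
        hL.sum_le (partitionPoint_mono hst.le n) (by rwa [partitionPoint_zero]) n
          (by rwa [partitionPoint_last])
    _ = L s t := by rw [partitionPoint_zero, partitionPoint_last]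

/-- The cells are half-open, so exactly one contains `x`, and the sum reduces to the mean of `L` on
this cell, an interval containing `x` that shrinks to `x`. -/
lemma tendsto_partitionDensity {L : ℝ → ℝ → ℝ≥0∞} {c : ℝ≥0∞} {s t x : ℝ} (hx : x ∈ Ioc s t)
    (hc : Tendsto (fun p : ℝ × ℝ => L p.1 p.2 / ENNReal.ofReal (p.2 - p.1))
      (straddleFilter x) (𝓝 c)) :
    Tendsto (fun n => partitionDensity L s t n x) atTop (𝓝 c) := by
  have hst : s < t := hx.1.trans_le hx.2
  have key : ∀ n : ℕ, ∃ p : ℝ × ℝ, p.1 < p.2 ∧ p.1 ≤ x ∧ x ≤ p.2 ∧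
      p.2 - p.1 = (t - s) / (n + 1) ∧
      partitionDensity L s t n x = L p.1 p.2 / ENNReal.ofReal (p.2 - p.1) := by
    intro n
    have hpos : 0 < (t - s) / ((n : ℝ) + 1) := div_pos (by linarith) (by positivity)
    have hm := partitionPoint_mono hst.le n
    have hx' : x ∈ ⋃ i ∈ Finset.range (n + 1),
        Ioc (partitionPoint s t n i) (partitionPoint s t n (i + 1)) := by
      rw [iUnion_Ioc_of_monotone hm, partitionPoint_zero, partitionPoint_last]; exact hx
    obtain ⟨i, hi, hxi⟩ := mem_iUnion₂.1 hx'
    have hlen : partitionPoint s t n (i + 1) - partitionPoint s t n i = (t - s) / (n + 1) := by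
      rw [partitionPoint_succ]; ring
    refine ⟨(partitionPoint s t n i, partitionPoint s t n (i + 1)), hxi.1.trans_le hxi.2, hxi.1.le,
      hxi.2, hlen, ?_⟩
    unfold partitionDensity
    rw [Finset.sum_eq_single i, indicator_of_mem hxi, hlen]
    · intro j _ hji
      refine indicator_of_notMem (fun hxj => ?_) _
      rcases lt_or_gt_of_ne hji with h | h
      · exact absurd (hxj.2.trans (hm (Nat.succ_le_of_lt h))) (not_le.2 hxi.1)
      · exact absurd (hxi.2.trans (hm (Nat.succ_le_of_lt h))) (not_le.2 hxj.1)
    · exact fun h => absurd hi h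
  choose p hp1 hp2 hp3 hp4 hp5 using key
  have hlim : Tendsto p atTop (straddleFilter x) := by
    refine tendsto_straddleFilter (δ := fun n : ℕ => (t - s) / ((n : ℝ) + 1)) ?_
      (Eventually.of_forall fun n => ⟨hp1 n, hp2 n, hp3 n, (hp4 n).le⟩)
    have := (tendsto_one_div_add_atTop_nhds_zero_nat (𝕜 := ℝ)).const_mul (t - s)
    simpa [div_eq_mul_inv] using this
  simp_rw [hp5]
  exact hc.comp hlim

/-- Test on `A ∩ s`, where `s` has full `ν`-measure and is not charged by the singular part: there
`μ` agrees with its absolutely continuous part. -/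
lemma ae_le_rnDeriv_of_withDensity_le {μ ν : Measure ℝ} [μ.HaveLebesgueDecomposition ν]
    [SigmaFinite ν] {f : ℝ → ℝ≥0∞} (hf : Measurable f) (h : ν.withDensity f ≤ μ) :
    f ≤ᵐ[ν] μ.rnDeriv ν := by
  refine ae_le_of_forall_setLIntegral_le_of_sigmaFinite hf fun A hA _ => ?_
  obtain ⟨s, hs, hs1, hs2⟩ := Measure.mutuallySingular_singularPart μ ν
  have hAs : ν.restrict A = ν.restrict (A ∩ s) := by
    refine Measure.restrict_congr_set (inter_ae_eq_left_of_ae_eq_univ ?_).symm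
    exact eventuallyEq_univ.2 hs2
  calc ∫⁻ x in A, f x ∂ν = ν.withDensity f (A ∩ s) := by
        rw [hAs, withDensity_apply _ (hA.inter hs)]
    _ ≤ μ (A ∩ s) := h _
    _ = ν.withDensity (μ.rnDeriv ν) (A ∩ s) := by
        conv_lhs => rw [← Measure.singularPart_add_rnDeriv μ ν]
        rw [Measure.add_apply, measure_mono_null inter_subset_right hs1, zero_add]
    _ = ∫⁻ x in A, μ.rnDeriv ν x ∂ν := by rw [hAs, withDensity_apply _ (hA.inter hs)]

section

variable {L : ℝ → ℝ → ℝ≥0∞} {F : ℝ → ℝ≥0∞}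

lemma sigmaFinite_greatestMinorant (hL : IntervalSuperadditive L) (h0 : L 0 0 < ⊤)
    (hfin : ∀ t ∈ Ioc (0 : ℝ) 1, ∃ a < t, 0 ≤ a ∧ L a t < ⊤) :
    SigmaFinite (greatestMinorant L) := by
  refine sigmaFinite_of_forall_left (greatestMinorant_isGreatest hL).1.1 ?_ fun t ht => ?_
  · rw [← Icc_self]
    exact (greatestMinorant_Icc_le hL le_rfl le_rfl zero_le_one).trans_lt h0
  · obtain ⟨a, hat, ha0, ha⟩ := hfin t ht
    exact ⟨a, hat, (measure_mono Ioc_subset_Icc_self).trans_lt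
      ((greatestMinorant_Icc_le hL ha0 hat.le ht.2).trans_lt ha)⟩

/-- Symmetric intervals around `x` have mass at most `L`, so differentiation of measures bounds the
density by the limit of the means of `L`. -/
lemma rnDeriv_greatestMinorant_le (hL : IntervalSuperadditive L) (h0 : L 0 0 < ⊤)
    (hfin : ∀ t ∈ Ioc (0 : ℝ) 1, ∃ a < t, 0 ≤ a ∧ L a t < ⊤)
    (hF : ∀ᵐ t ∂(volume.restrict (Icc (0 : ℝ) 1)),
      Tendsto (fun p : ℝ × ℝ => L p.1 p.2 / ENNReal.ofReal (p.2 - p.1))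
        (straddleFilter t) (𝓝 (F t))) :
    ∀ᵐ t ∂(volume.restrict (Icc (0 : ℝ) 1)), (greatestMinorant L).rnDeriv volume t ≤ F t := by
  have := sigmaFinite_greatestMinorant hL h0 hfin
  refine ae_restrict_Icc_of_forall_left fun b hb => ?_
  obtain ⟨a, hab, ha0, ha⟩ := hfin b hb
  refine ⟨a, hab, ?_⟩
  set μ := greatestMinorant L
  -- `μ` is only known to be σ-finite, while the differentiation theorem needs local finiteness:
  -- restrict to an interval of finite mass, inside which the density is unchanged.
  have hfinite : IsFiniteMeasure (μ.restrict (Icc a b)) :=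
    ⟨by rw [Measure.restrict_apply_univ]
        exact (greatestMinorant_Icc_le hL ha0 hab.le hb.2).trans_lt ha⟩
  rw [ae_restrict_iff' measurableSet_Icc] at hF
  filter_upwards [hF, Besicovitch.ae_tendsto_rnDeriv (μ.restrict (Icc a b)) volume,
    Measure.rnDeriv_restrict μ volume (measurableSet_Icc (a := a) (b := b))] with x hx1 hx2 hx3 hx
  rw [hx3, indicator_of_mem (Ioo_subset_Icc_self hx)] at hx2
  have hlim : Tendsto (fun r : ℝ => (x - r, x + r)) (𝓝[>] 0) (straddleFilter x) := by
    refine tendsto_straddleFilter (δ := fun r => 2 * r) ?_ ?_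
    · exact (Continuous.tendsto' (by fun_prop) _ _ (by simp)).mono_left nhdsWithin_le_nhds
    · filter_upwards [self_mem_nhdsWithin] with r hr
      have : 0 < r := hr
      exact ⟨by linarith, by linarith, by linarith, by linarith⟩
  refine le_of_tendsto_of_tendsto hx2
    ((hx1 ⟨ha0.trans hx.1.le, hx.2.le.trans hb.2⟩).comp hlim) ?_
  have hnear : ∀ᶠ r : ℝ in 𝓝[>] 0, r < min (x - a) (b - x) :=
    nhdsWithin_le_nhds (gt_mem_nhds (lt_min (by linarith [hx.1]) (by linarith [hx.2])))
  filter_upwards [self_mem_nhdsWithin, hnear] with r hr hr'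
  have hr0 : 0 < r := hr
  have h1 := (lt_min_iff.1 hr').1
  have h2 := (lt_min_iff.1 hr').2
  rw [Real.closedBall_eq_Icc, Real.volume_Icc]
  simp only [Function.comp]
  gcongr
  refine (Measure.restrict_apply_le _ _).trans
    (greatestMinorant_Icc_le hL (by linarith) (by linarith) (by linarith [hb.2]))

/-- `F` is almost everywhere a limit of step functions, so no measurability of `L` is required. -/
lemma aemeasurable_of_tendsto_straddleFilter
    (hF : ∀ᵐ t ∂(volume.restrict (Icc (0 : ℝ) 1)),
      Tendsto (fun p : ℝ × ℝ => L p.1 p.2 / ENNReal.ofReal (p.2 - p.1))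
        (straddleFilter t) (𝓝 (F t))) : AEMeasurable F (volume.restrict (Icc (0 : ℝ) 1)) := by
  refine aemeasurable_of_tendsto_metrizable_ae' (f := partitionDensity L 0 1)
    (fun n => (measurable_partitionDensity L 0 1 n).aemeasurable) ?_
  rw [← restrict_Ioc_eq_restrict_Icc] at *
  filter_upwards [hF, ae_restrict_mem measurableSet_Ioc] with x hx hx'
  exact tendsto_partitionDensity hx' hx

/-- Fatou's lemma for the step functions of the partitions of `[s,t]`, whose integrals are at most
`L s t` by superadditivity. -/
lemma setLIntegral_le_of_tendsto_straddleFilter (hL : IntervalSuperadditive L)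
    (hF : ∀ᵐ t ∂(volume.restrict (Icc (0 : ℝ) 1)),
      Tendsto (fun p : ℝ × ℝ => L p.1 p.2 / ENNReal.ofReal (p.2 - p.1))
        (straddleFilter t) (𝓝 (F t)))
    {s t : ℝ} (h0 : 0 ≤ s) (hst : s ≤ t) (h1 : t ≤ 1) : ∫⁻ x in Icc s t, F x ≤ L s t := by
  rcases hst.eq_or_lt with rfl | hlt
  · simp
  rw [← restrict_Ioc_eq_restrict_Icc]
  calc ∫⁻ x in Ioc s t, F x
      = ∫⁻ x in Ioc s t, liminf (fun n => partitionDensity L s t n x) atTop := by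
        refine lintegral_congr_ae ?_
        have hF' := ae_restrict_of_ae_restrict_of_subset
          (Ioc_subset_Icc_self.trans (Icc_subset_Icc h0 h1) : Ioc s t ⊆ Icc 0 1) hF
        filter_upwards [hF', ae_restrict_mem measurableSet_Ioc] with x hx hx'
        exact (tendsto_partitionDensity hx' hx).liminf_eq.symm
    _ ≤ liminf (fun n => ∫⁻ x in Ioc s t, partitionDensity L s t n x) atTop :=
        lintegral_liminf_le fun n => measurable_partitionDensity L s t n
    _ ≤ L s t := by
        refine liminf_le_of_le (by isBoundedDefault) fun b hb => ?_
        obtain ⟨n, hn⟩ := hb.exists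
        exact hn.trans ((setLIntegral_le_lintegral _ _).trans
          (lintegral_partitionDensity_le hL h0 hlt h1 n))

/-- If the mean values of `L` on the intervals shrinking to `t` converge to `F t`, then `F` is the
density of the largest measure below `L`. -/
theorem rnDeriv_greatestMinorant (hL : IntervalSuperadditive L) (h0 : L 0 0 < ⊤)
    (hfin : ∀ t ∈ Ioc (0 : ℝ) 1, ∃ a < t, 0 ≤ a ∧ L a t < ⊤)
    (hF : ∀ᵐ t ∂(volume.restrict (Icc (0 : ℝ) 1)),
      Tendsto (fun p : ℝ × ℝ => L p.1 p.2 / ENNReal.ofReal (p.2 - p.1))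
        (straddleFilter t) (𝓝 (F t))) :
    ∀ᵐ t ∂(volume.restrict (Icc (0 : ℝ) 1)), (greatestMinorant L).rnDeriv volume t = F t := by
  have := sigmaFinite_greatestMinorant hL h0 hfin
  have hm := aemeasurable_of_tendsto_straddleFilter hF
  -- A measurable version of `F`, cut off outside `[0,1]`, is the density of a minorant; maximality
  -- then gives the lower bound.
  set f : ℝ → ℝ≥0∞ := (Icc (0 : ℝ) 1).indicator (hm.mk F) with hf
  have hfm : Measurable f := hm.measurable_mk.indicator measurableSet_Icc
  have hmin : volume.withDensity f ∈ intervalMinorants L := by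
    refine ⟨?_, fun s t h0 hst h1 => ?_⟩
    · rw [withDensity_apply _ measurableSet_Icc.compl, hf,
        lintegral_indicator measurableSet_Icc, Measure.restrict_restrict measurableSet_Icc]
      simp
    · refine le_trans (le_of_eq ?_) (setLIntegral_le_of_tendsto_straddleFilter hL hF h0 hst h1)
      rw [withDensity_apply _ measurableSet_Icc]
      refine lintegral_congr_ae ?_
      have h := ae_restrict_of_ae_restrict_of_subset (Icc_subset_Icc h0 h1) hm.ae_eq_mk
      filter_upwards [h, ae_restrict_mem measurableSet_Icc] with x hx hx'
      rw [hf, indicator_of_mem (Icc_subset_Icc h0 h1 hx'), hx]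
  have hle := ae_le_rnDeriv_of_withDensity_le hfm (le_greatestMinorant hmin)
  filter_upwards [rnDeriv_greatestMinorant_le hL h0 hfin hF, ae_restrict_of_ae hle, hm.ae_eq_mk,
    ae_restrict_mem measurableSet_Icc] with x h1 h2 h3 h4
  refine le_antisymm h1 ?_
  rwa [hf, indicator_of_mem h4, ← h3] at h2

end

/-! ### Lorentzian bilinear forms -/

section Lorentz

variable {E : Type*} [NormedAddCommGroup E] [NormedSpace ℝ E]

/-- A symmetric bilinear form that is positive definite on the orthogonal complement of every
timelike vector. -/
structure IsLorentzianForm (B : E →L[ℝ] E →L[ℝ] ℝ) : Prop where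
  symm : ∀ v w, B v w = B w v
  pos : ∀ u w, B u u < 0 → B u w = 0 → w ≠ 0 → 0 < B w w

/-- Zero and the causal vectors in the same cone as the timelike vector `X`. -/
def InFutureCone (B : E →L[ℝ] E →L[ℝ] ℝ) (X w : E) : Prop :=
  w = 0 ∨ (B w w ≤ 0 ∧ B w X < 0)

/-- With `x, y` the time components and `S, W` the squared space components of `u, w`: orthogonality
makes `x y` the spatial product, so `x² y² ≤ S W` by Cauchy-Schwarz. As `S < x²`, having `W ≤ y²`
forces `y = 0`, then `W = 0` and `w = 0`. -/
lemma isLorentzianForm_of_basis {d : ℕ} {B : E →L[ℝ] E →L[ℝ] ℝ} (hs : ∀ v w, B v w = B w v)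
    (b : Module.Basis (Fin (d + 1)) ℝ E)
    (hb : ∀ i j, B (b i) (b j) = if i = j then (if i = 0 then -1 else 1) else 0) :
    IsLorentzianForm B := by
  have key : ∀ v w, B v w = -(b.repr v 0 * b.repr w 0) +
      ∑ i : Fin d, b.repr v i.succ * b.repr w i.succ := by
    intro v w
    have h1 : B v w = ∑ i, ∑ j, b.repr v i * (b.repr w j * B (b i) (b j)) := by
      conv_lhs => rw [← b.sum_repr v, ← b.sum_repr w]
      simp only [map_sum, sum_apply, map_smul, smul_apply, smul_eq_mul, Finset.mul_sum]
      rw [Finset.sum_comm]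
      exact Finset.sum_congr rfl fun i _ => Finset.sum_congr rfl fun j _ => by ring
    rw [h1]
    simp only [hb, mul_ite, mul_one, mul_zero, Finset.sum_ite_eq, Finset.mem_univ, if_true]
    rw [Fin.sum_univ_succ]
    simp [Fin.succ_ne_zero]
  refine ⟨hs, fun u w hu huw hw => ?_⟩
  rw [key] at hu huw
  rw [key]
  have hcs := Finset.sum_mul_sq_le_sq_mul_sq Finset.univ (fun i : Fin d => b.repr u i.succ)
    (fun i : Fin d => b.repr w i.succ)
  simp only [pow_two] at hcs
  set S := ∑ i : Fin d, b.repr u i.succ * b.repr u i.succ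
  set P := ∑ i : Fin d, b.repr u i.succ * b.repr w i.succ
  set W := ∑ i : Fin d, b.repr w i.succ * b.repr w i.succ with hW
  set x := b.repr u 0
  set y := b.repr w 0 with hy
  by_contra! hcon
  have hW0 : 0 ≤ W := Finset.sum_nonneg fun i _ => mul_self_nonneg _
  have hS0 : 0 ≤ S := Finset.sum_nonneg fun i _ => mul_self_nonneg _
  have hP : P = x * y := by linarith
  have h1 : x * y * (x * y) ≤ S * (y * y) := by
    rw [← hP]; exact hcs.trans (mul_le_mul_of_nonneg_left (by linarith) hS0)
  have hy0 : y = 0 := by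
    by_contra hne
    have : 0 < y * y := mul_self_pos.2 hne
    nlinarith
  have hWz : W = 0 := by rw [hy0] at hcon; linarith
  apply hw
  apply b.repr.map_eq_zero_iff.1
  ext i
  refine Fin.cases ?_ (fun j => ?_) i
  · simpa using hy0
  · have := (Finset.sum_eq_zero_iff_of_nonneg (fun i _ => mul_self_nonneg _)).1 hWz j
      (Finset.mem_univ j)
    simpa using this

namespace IsLorentzianForm

variable {B : E →L[ℝ] E →L[ℝ] ℝ} (hB : IsLorentzianForm B)

include hB in
lemma nonneg {u w : E} (hu : B u u < 0) (huw : B u w = 0) : 0 ≤ B w w := by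
  by_cases h : w = 0
  · simp [h]
  · exact (hB.pos u w hu huw h).le

include hB in
/-- The reverse Cauchy-Schwarz inequality. -/
lemma mul_le_sq {u : E} (hu : B u u < 0) (w : E) : B u u * B w w ≤ (B u w) ^ 2 := by
  have h : 0 ≤ B (B u w • u - B u u • w) (B u w • u - B u u • w) := by
    refine hB.nonneg hu ?_
    simp; ring
  simp only [map_sub, map_smul, sub_apply, smul_apply, smul_eq_mul, hB.symm w u] at h
  by_contra! hcon
  nlinarith

include hB in
/-- Causal vectors in the same cone have a nonpositive product. -/
lemma apply_nonpos {X u w : E} (hX : B X X < 0) (hu : B u u < 0) (huX : B u X < 0)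
    (hw : InFutureCone B X w) : B u w ≤ 0 := by
  rcases hw with rfl | ⟨hw, hwX⟩
  · simp
  -- This combination is orthogonal to `X`, hence not timelike; with `B u w > 0` every term of its
  -- square would be nonpositive and one negative.
  have h : 0 ≤ B (B w X • u - B u X • w) (B w X • u - B u X • w) := by
    refine hB.nonneg hX ?_
    simp [hB.symm X u, hB.symm X w]; ring
  simp only [map_sub, map_smul, sub_apply, smul_apply, smul_eq_mul, hB.symm w u] at h
  by_contra! hcon
  have h1 : 0 < (B w X) * (B u X) := mul_pos_of_neg_of_neg hwX huX
  have h2 : (B w X) * (B w X) * B u u < 0 := mul_neg_of_pos_of_neg (mul_self_pos.2 hwX.ne) hu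
  have h3 : (B u X) * (B u X) * B w w ≤ 0 :=
    mul_nonpos_of_nonneg_of_nonpos (mul_self_nonneg _) hw
  have h4 : 0 < (B w X) * (B u X) * B u w := mul_pos h1 hcon
  nlinarith

include hB in
lemma sqrt_mul_sqrt_le {X u w : E} (hX : B X X < 0) (hu : B u u < 0) (huX : B u X < 0)
    (hw : InFutureCone B X w) : √(-B w w) * √(-B u u) ≤ -B u w := by
  have h0 := hB.apply_nonpos hX hu huX hw
  have hww : B w w ≤ 0 := by
    rcases hw with rfl | h
    · simp
    · exact h.1
  rw [← Real.sqrt_mul (by linarith)]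
  refine Real.sqrt_le_iff.2 ⟨by linarith, ?_⟩
  have := hB.mul_le_sq hu w
  nlinarith

include hB in
/-- The future cone and the Lorentz norm are determined by the products with timelike vectors. -/
lemma le_sqrt_of_forall_timelike {X v : E} (hX : B X X < 0) {D : ℝ} (hD : 0 ≤ D)
    (h : ∀ u, B u u < 0 → B u X < 0 → D * √(-B u u) ≤ -B u v) :
    B v v ≤ 0 ∧ D ≤ √(-B v v) := by
  obtain ⟨N, hN⟩ : ∃ N, N = -B X X := ⟨_, rfl⟩
  have hN0 : 0 < N := by linarith
  obtain ⟨a, ha⟩ : ∃ a, a = -B X v / N := ⟨_, rfl⟩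
  have haN : a * N = -B X v := by rw [ha]; field_simp
  obtain ⟨z, hz⟩ : ∃ z, z = v - a • X := ⟨_, rfl⟩
  have hXz : B X z = 0 := by
    rw [hz]; simp; linarith [show a * B X X = -(a * N) by rw [hN]; ring]
  have hzX : B z X = 0 := by rw [hB.symm]; exact hXz
  obtain ⟨q, hq⟩ : ∃ q, q = B z z := ⟨_, rfl⟩
  have hq0 : 0 ≤ q := by rw [hq]; exact hB.nonneg hX hXz
  have hv : v = a • X + z := by rw [hz]; abel
  have hvv : B v v = -(a ^ 2 * N) + q := by
    rw [hv]; simp [hXz, hzX, ← hq]; rw [hN]; ring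
  -- Testing with `u = b X + z`, which is future timelike once `b > 0` and `b² N > q`, reduces the
  -- claim to scalar inequalities in `b`.
  have hb : ∀ b : ℝ, 0 < b → q < b ^ 2 * N → D * √(b ^ 2 * N - q) ≤ a * b * N - q := by
    intro b hb0 hbq
    have e1 : B (b • X + z) (b • X + z) = -(b ^ 2 * N - q) := by
      simp [hXz, hzX, ← hq]; rw [hN]; ring
    have e2 : B (b • X + z) v = -(a * b * N - q) := by
      rw [hv]; simp [hXz, hzX, ← hq]; rw [hN]; ring
    have e3 : B (b • X + z) X < 0 := by
      simp [hzX]; exact mul_neg_of_pos_of_neg hb0 hX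
    have := h (b • X + z) (by rw [e1]; linarith) e3
    rwa [e1, e2, neg_neg, neg_neg] at this
  have ha0 : 0 ≤ a := by
    have := h X hX hX
    have h2 : 0 ≤ D * √(-B X X) := by positivity
    have h3 : 0 ≤ a * N := by linarith
    exact nonneg_of_mul_nonneg_left h3 hN0
  -- If `v` were spacelike, there would be an admissible `b` with `a b N < q`, which makes the right
  -- side of `hb` negative.
  have hcausal : q ≤ a ^ 2 * N := by
    by_contra! hcon
    have hqpos : 0 < q := lt_of_le_of_lt (by positivity) hcon
    obtain ⟨b, hb1, hb2⟩ : ∃ b : ℝ, √(q / N) < b ∧ a * b * N < q := by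
      rcases ha0.eq_or_lt with rfl | hapos
      · exact ⟨√(q / N) + 1, by linarith, by simpa using hqpos⟩
      · have : √(q / N) < q / (a * N) := by
          rw [Real.sqrt_lt' (by positivity), div_pow, div_lt_div_iff₀ (by positivity) (by positivity)]
          have := mul_lt_mul_of_pos_left hcon (mul_pos hqpos hN0)
          nlinarith
        obtain ⟨b, h1, h2⟩ := exists_between this
        refine ⟨b, h1, ?_⟩
        rw [lt_div_iff₀ (by positivity)] at h2
        linarith
    have hb0 : 0 < b := (Real.sqrt_nonneg _).trans_lt hb1
    have hbq : q < b ^ 2 * N := by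
      rw [Real.sqrt_lt' hb0, div_lt_iff₀ hN0] at hb1
      exact hb1
    have := hb b hb0 hbq
    have h2 : 0 ≤ D * √(b ^ 2 * N - q) := by positivity
    linarith
  refine ⟨by rw [hvv]; linarith, ?_⟩
  have hm : -B v v = a ^ 2 * N - q := by rw [hvv]; ring
  rw [hm]
  rcases hcausal.eq_or_lt with heq | hlt
  · by_contra! hcon
    rw [heq, sub_self, Real.sqrt_zero] at hcon
    rcases ha0.eq_or_lt with ha' | hapos
    · have hq' : q = 0 := by rw [heq, ← ha']; ring
      have := hb 1 one_pos (by rw [hq']; simpa using hN0)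
      rw [← ha', hq'] at this
      have h2 : 0 < D * √(1 ^ 2 * N - 0) := mul_pos hcon (Real.sqrt_pos.2 (by simpa using hN0))
      linarith
    -- For null `v ≠ 0`, this `k` makes the right side of `hb` at `b = a + k` equal to `D²`, while
    -- the left side is larger if `D > 0`.
    · obtain ⟨k, hk⟩ : ∃ k, k = D ^ 2 / (a * N) := ⟨_, rfl⟩
      have hkpos : 0 < k := by rw [hk]; positivity
      have hkD : k * (a * N) = D ^ 2 := by rw [hk]; field_simp
      have h1 := hb (a + k) (by linarith) (by
        rw [heq]; nlinarith [mul_pos (mul_pos hapos hkpos) hN0, mul_pos (mul_pos hkpos hkpos) hN0])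
      have e1 : (a + k) ^ 2 * N - q = k * (2 * a + k) * N := by rw [heq]; ring
      have e2 : a * (a + k) * N - q = D ^ 2 := by rw [heq, ← hkD]; ring
      rw [e1, e2] at h1
      have h3 : √(k * (2 * a + k) * N) ≤ D := by
        rw [pow_two] at h1
        exact le_of_mul_le_mul_left h1 hcon
      have h4 : k * (2 * a + k) * N ≤ D ^ 2 := (Real.sqrt_le_left hcon.le).1 h3
      nlinarith [mul_pos hkpos hkpos, mul_pos (mul_pos hkpos hapos) hN0,
        mul_pos (mul_pos hkpos hkpos) hN0]
  · have hapos : 0 < a := by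
      rcases ha0.eq_or_lt with ha' | h'
      · rw [← ha'] at hlt; simp at hlt; linarith
      · exact h'
    -- For timelike `v`, the choice `b = a` tests with `v` itself.
    have := hb a hapos hlt
    have hpos : 0 < √(a ^ 2 * N - q) := Real.sqrt_pos.2 (by linarith)
    have h2 : a * a * N - q = √(a ^ 2 * N - q) * √(a ^ 2 * N - q) := by
      rw [Real.mul_self_sqrt (by linarith)]; ring
    rw [h2] at this
    exact le_of_mul_le_mul_right this hpos

end IsLorentzianForm

end Lorentz

/-! ### Perturbation of Lorentzian forms -/

section LorentzPerturbation

variable {E : Type*} [NormedAddCommGroup E] [NormedSpace ℝ E]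
  {P : Type*} {l : Filter P} {B : P → E →L[ℝ] E →L[ℝ] ℝ} {X : P → E}
  {B₀ : E →L[ℝ] E →L[ℝ] ℝ} {X₀ : E}

/-- The added term reverses the sign of the form along `X₀` and changes nothing on the orthogonal
complement. The result is positive definite, and `c` is a positive lower bound on the compact unit
sphere. -/
lemma IsLorentzianForm.exists_coercive [FiniteDimensional ℝ E] (hB : IsLorentzianForm B₀)
    (hX : B₀ X₀ X₀ < 0) :
    ∃ c > 0, ∀ w, c * ‖w‖ ^ 2 ≤ B₀ w w + 2 * (B₀ w X₀) ^ 2 / (-B₀ X₀ X₀) := by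
  set h : E → ℝ := fun w => B₀ w w + 2 * (B₀ w X₀) ^ 2 / (-B₀ X₀ X₀) with hh
  have hN : 0 < -B₀ X₀ X₀ := by linarith
  have hcont : Continuous h := by fun_prop
  have hpos : ∀ w, w ≠ 0 → 0 < h w := by
    intro w hw
    set a := -B₀ w X₀ / (-B₀ X₀ X₀) with ha
    have haN : a * (-B₀ X₀ X₀) = -B₀ w X₀ := by
      rw [ha, div_mul_cancel₀ _ hN.ne']
    obtain ⟨z, hz⟩ : ∃ z, z = w - a • X₀ := ⟨_, rfl⟩
    have hXw : B₀ X₀ w = B₀ w X₀ := hB.symm _ _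
    have hXz : B₀ X₀ z = 0 := by
      rw [hz]; simp only [map_sub, map_smul, smul_eq_mul]; linarith
    have hzz : B₀ z z = B₀ w w + (B₀ w X₀) ^ 2 / (-B₀ X₀ X₀) := by
      have h1 : B₀ z z = B₀ w w - a * B₀ w X₀ := by
        have h2 : B₀ z z = B₀ w z - a * B₀ X₀ z := by
          have h3 : B₀ z = B₀ w - a • B₀ X₀ := by rw [hz, map_sub, map_smul]
          rw [h3, sub_apply, smul_apply, smul_eq_mul]
        rw [h2, hXz, hz]; simp only [map_sub, map_smul, smul_eq_mul]; ring
      rw [h1, ha]; ring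
    have hhz : h w = B₀ z z + (B₀ w X₀) ^ 2 / (-B₀ X₀ X₀) := by rw [hzz, hh]; ring
    have hnn : 0 ≤ (B₀ w X₀) ^ 2 / (-B₀ X₀ X₀) := by positivity
    by_cases hz0 : z = 0
    · have hw' : w = a • X₀ := by rw [hz, sub_eq_zero] at hz0; exact hz0
      have ha0 : a ≠ 0 := by rintro h0; rw [h0, zero_smul] at hw'; exact hw hw'
      have hwX : B₀ w X₀ ≠ 0 := by
        intro h0; rw [h0, neg_zero] at haN
        exact (mul_ne_zero ha0 hN.ne') haN
      rw [hhz, hz0]; simp only [map_zero, zero_add]; positivity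
    · have := hB.pos X₀ z hX hXz hz0
      rw [hhz]; linarith
  have hcpt : IsCompact (Metric.sphere (0 : E) 1) := isCompact_sphere _ _
  obtain ⟨c, hc, hc'⟩ := hcpt.exists_forall_le' (a := 0) hcont.continuousOn fun w hw => hpos w (by
    rintro rfl; simp at hw)
  refine ⟨c, hc, fun w => ?_⟩
  by_cases hw : w = 0
  · simp [hw]
  have hn : 0 < ‖w‖ := norm_pos_iff.2 hw
  have h1 := hc' (‖w‖⁻¹ • w) (by simp [norm_smul, hn.ne'])
  have h2 : h (‖w‖⁻¹ • w) = (‖w‖⁻¹) ^ 2 * h w := by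
    simp only [hh, map_smul, smul_apply, smul_eq_mul]; ring
  rw [h2, inv_pow, ← div_eq_inv_mul, le_div_iff₀ (by positivity)] at h1
  exact h1

lemma abs_apply_le (B : E →L[ℝ] E →L[ℝ] ℝ) (v w : E) : |B v w| ≤ ‖B‖ * ‖v‖ * ‖w‖ := by
  have := B.le_opNorm₂ v w
  rwa [Real.norm_eq_abs] at this

lemma eventually_abs_apply_sub_le (hBl : Tendsto B l (𝓝 B₀)) {ε : ℝ} (hε : 0 < ε) :
    ∀ᶠ p in l, ∀ v w, |B p v w - B₀ v w| ≤ ε * ‖v‖ * ‖w‖ := by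
  filter_upwards [((tendsto_iff_norm_sub_tendsto_zero (E := E →L[ℝ] E →L[ℝ] ℝ)).1 hBl).eventually (gt_mem_nhds hε)] with p hp v w
  refine (abs_apply_le (B p - B₀) v w).trans ?_
  gcongr

lemma tendsto_apply_apply {v w : P → E} {v₀ w₀ : E} (hB : Tendsto B l (𝓝 B₀)) (hv : Tendsto v l (𝓝 v₀))
    (hw : Tendsto w l (𝓝 w₀)) : Tendsto (fun p => B p (v p) (w p)) l (𝓝 (B₀ v₀ w₀)) := by
  have hc : Continuous fun q : (E →L[ℝ] E →L[ℝ] ℝ) × E × E => q.1 q.2.1 q.2.2 := by fun_prop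
  exact (hc.tendsto (B₀, v₀, w₀)).comp (hB.prodMk_nhds (hv.prodMk_nhds hw))

/-- Nearby future cones lie in a fixed half space, away from its boundary. -/
lemma eventually_inFutureCone_coercive [FiniteDimensional ℝ E] (hB : IsLorentzianForm B₀)
    (hX : B₀ X₀ X₀ < 0) (hBl : Tendsto B l (𝓝 B₀)) (hXl : Tendsto X l (𝓝 X₀)) :
    ∃ k > 0, ∀ᶠ p in l, ∀ w, InFutureCone (B p) (X p) w → k * ‖w‖ ≤ -B₀ w X₀ := by
  obtain ⟨c, hc, hcw⟩ := hB.exists_coercive hX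
  have hN : 0 < -B₀ X₀ X₀ := by linarith
  -- Closeness of `B p` to `B₀` within `c / 2` leaves `c / 2 * ‖w‖² ≤ 2 (B₀ w X₀)² / (-B₀ X₀ X₀)`,
  -- that is `k ‖w‖ ≤ |B₀ w X₀|` for this `k`.
  obtain ⟨k, hk⟩ : ∃ k, k = √(-B₀ X₀ X₀ * c / 4) := ⟨_, rfl⟩
  have hkpos : 0 < k := by rw [hk]; positivity
  have hk2 : k ^ 2 = -B₀ X₀ X₀ * c / 4 := by rw [hk, Real.sq_sqrt (by positivity)]
  refine ⟨k, hkpos, ?_⟩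
  have e1 := eventually_abs_apply_sub_le hBl (half_pos hc)
  have e2 : ∀ᶠ p in l, ∀ w, |B p w (X p) - B₀ w X₀| ≤ k / 2 * ‖w‖ := by
    have hpos : 0 < k / (4 * (‖X₀‖ + 1)) := by positivity
    have h1 := (tendsto_iff_norm_sub_tendsto_zero.1 hXl).eventually
      (gt_mem_nhds (show 0 < min 1 (k / (4 * (‖B₀‖ + 1))) by positivity))
    filter_upwards [h1, eventually_abs_apply_sub_le hBl hpos] with p hp1 hp2 w
    have h3 := (lt_min_iff.1 hp1).1
    have h4 := (lt_min_iff.1 hp1).2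
    rw [lt_div_iff₀ (by positivity)] at h4
    have h5 : ‖X p‖ ≤ ‖X₀‖ + 1 := by
      have := norm_sub_norm_le (X p) X₀; linarith
    have h6 : |B p w (X p) - B₀ w (X p)| ≤ k / 4 * ‖w‖ := by
      calc _ ≤ k / (4 * (‖X₀‖ + 1)) * ‖w‖ * ‖X p‖ := hp2 w (X p)
        _ ≤ k / (4 * (‖X₀‖ + 1)) * ‖w‖ * (‖X₀‖ + 1) := by gcongr
        _ = k / 4 * ‖w‖ := by field_simp
    have h7 : |B₀ w (X p - X₀)| ≤ k / 4 * ‖w‖ := by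
      refine (abs_apply_le B₀ w _).trans ?_
      have : ‖B₀‖ * ‖X p - X₀‖ ≤ k / 4 := by nlinarith [norm_nonneg (X p - X₀)]
      calc ‖B₀‖ * ‖w‖ * ‖X p - X₀‖ = ‖B₀‖ * ‖X p - X₀‖ * ‖w‖ := by ring
        _ ≤ _ := by gcongr
    rw [map_sub] at h7
    calc |B p w (X p) - B₀ w X₀|
        = |(B p w (X p) - B₀ w (X p)) + (B₀ w (X p) - B₀ w X₀)| := by ring_nf
      _ ≤ _ := (abs_add_le _ _).trans (by linarith)
  filter_upwards [e1, e2] with p hp1 hp2 w hw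
  rcases hw with rfl | ⟨hww, hwX⟩
  · simp
  have hn : 0 ≤ ‖w‖ := norm_nonneg w
  have h1 : B₀ w w ≤ c / 2 * ‖w‖ ^ 2 := by
    have h := (abs_le.1 (hp1 w w)).1
    nlinarith
  have h2 : -(k / 2 * ‖w‖) ≤ -B₀ w X₀ := by
    have h := (abs_le.1 (hp2 w)).1
    linarith
  have h3 : (k * ‖w‖) ^ 2 ≤ (-B₀ w X₀) ^ 2 := by
    have h := hcw w
    have h4 : c / 2 * ‖w‖ ^ 2 ≤ 2 * (B₀ w X₀) ^ 2 / (-B₀ X₀ X₀) := by linarith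
    rw [le_div_iff₀ hN] at h4
    rw [mul_pow, hk2]
    nlinarith
  have h5 := sq_le_sq.1 h3
  rw [abs_of_nonneg (by positivity : 0 ≤ k * ‖w‖)] at h5
  -- Only the sign of `B₀ w X₀` is open: `h2` excludes the wrong one unless `w = 0`, and `hwX`
  -- excludes that.
  by_contra! hcon
  rcases le_abs'.1 h5 with h6 | h6
  · have : 0 ≤ k * ‖w‖ := by positivity
    have h7 : k * ‖w‖ = 0 := by linarith
    have : ‖w‖ = 0 := by
      rcases mul_eq_zero.1 h7 with h | h
      · exact absurd h hkpos.ne'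
      · exact h
    rw [norm_eq_zero.1 this] at hwX
    simp at hwX
  · linarith

/-- A linear upper bound for the Lorentz norm on nearby future cones. -/
lemma eventually_sqrt_mul_sqrt_le (hBp : ∀ᶠ p in l, IsLorentzianForm (B p))
    (hX : ∀ᶠ p in l, B p (X p) (X p) < 0) (hBl : Tendsto B l (𝓝 B₀)) (hXl : Tendsto X l (𝓝 X₀))
    {u : E} (hu : B₀ u u < 0) (huX : B₀ u X₀ < 0) {η : ℝ} (hη : 0 < η) :
    ∀ᶠ p in l, ∀ w, InFutureCone (B p) (X p) w →
      √(-B p w w) * √(-B₀ u u) ≤ -B₀ u w + η * ‖w‖ := by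
  have t1 : Tendsto (fun p => B p u u) l (𝓝 (B₀ u u)) :=
    tendsto_apply_apply hBl tendsto_const_nhds tendsto_const_nhds
  have t2 : Tendsto (fun p => B p u (X p)) l (𝓝 (B₀ u X₀)) :=
    tendsto_apply_apply hBl tendsto_const_nhds hXl
  have hC : 0 < √(‖B₀‖ + 1) := Real.sqrt_pos.2 (by positivity)
  have t3 : Tendsto (fun p => |√(-B₀ u u) - √(-B p u u)|) l (𝓝 0) := by
    simpa using (t1.neg.sqrt.const_sub (√(-B₀ u u))).abs
  -- Two errors of `η / 2 * ‖w‖` are allowed: one for `B p u w` against `B₀ u w`, one for `√(-B p u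
  -- u)`, whose error is multiplied by `√(-B p w w) ≤ √(‖B₀‖ + 1) * ‖w‖`.
  have hη1 : 0 < min 1 (η / (2 * (‖u‖ + 1))) := by positivity
  have hη2 : 0 < η / (2 * √(‖B₀‖ + 1)) := by positivity
  filter_upwards [hBp, hX, t1.eventually (gt_mem_nhds hu), t2.eventually (gt_mem_nhds huX),
    t3.eventually (gt_mem_nhds hη2), eventually_abs_apply_sub_le hBl hη1] with p hp1 hp2 hp3 hp4 hp5
    hp6 w hw
  have h1 := hp1.sqrt_mul_sqrt_le hp2 hp3 hp4 hw
  have hn : 0 ≤ ‖w‖ := norm_nonneg w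
  have h2 : √(-B p w w) ≤ √(‖B₀‖ + 1) * ‖w‖ := by
    refine Real.sqrt_le_iff.2 ⟨by positivity, ?_⟩
    rw [mul_pow, Real.sq_sqrt (by positivity)]
    have h3 := (abs_le.1 (abs_apply_le B₀ w w)).1
    have h4 := (abs_le.1 (hp6 w w)).1
    have h5 : min 1 (η / (2 * (‖u‖ + 1))) * ‖w‖ * ‖w‖ ≤ 1 * ‖w‖ * ‖w‖ := by
      gcongr; exact min_le_left _ _
    nlinarith
  have h3 : -B p u w ≤ -B₀ u w + η / 2 * ‖w‖ := by
    have h4 := (abs_le.1 (hp6 u w)).1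
    have h5 : min 1 (η / (2 * (‖u‖ + 1))) * ‖u‖ * ‖w‖ ≤ η / 2 * ‖w‖ := by
      calc _ ≤ η / (2 * (‖u‖ + 1)) * (‖u‖ + 1) * ‖w‖ := by
            gcongr
            · exact min_le_right _ _
            · linarith
        _ = η / 2 * ‖w‖ := by field_simp
    linarith
  have h4 : √(-B p w w) * |√(-B₀ u u) - √(-B p u u)| ≤ η / 2 * ‖w‖ := by
    calc _ ≤ √(‖B₀‖ + 1) * ‖w‖ * (η / (2 * √(‖B₀‖ + 1))) := by gcongr
      _ = η / 2 * ‖w‖ := by field_simp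
  have h5 : √(-B p w w) * (√(-B₀ u u) - √(-B p u u)) ≤
      √(-B p w w) * |√(-B₀ u u) - √(-B p u u)| :=
    mul_le_mul_of_nonneg_left (le_abs_self _) (Real.sqrt_nonneg _)
  linarith

/-- Timelike future directed vectors and their Lorentz norm are stable under perturbation. -/
lemma eventually_timelike (hBl : Tendsto B l (𝓝 B₀)) (hXl : Tendsto X l (𝓝 X₀)) {v : E}
    (hv : B₀ v v < 0) (hvX : B₀ v X₀ < 0) {c : ℝ} (hc : c < √(-B₀ v v)) :
    ∀ᶠ q in l ×ˢ 𝓝 v, B q.1 q.2 q.2 < 0 ∧ B q.1 q.2 (X q.1) < 0 ∧ c < √(-B q.1 q.2 q.2) := by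
  have hB' : Tendsto (fun q : P × E => B q.1) (l ×ˢ 𝓝 v) (𝓝 B₀) := hBl.comp tendsto_fst
  have hX' : Tendsto (fun q : P × E => X q.1) (l ×ˢ 𝓝 v) (𝓝 X₀) := hXl.comp tendsto_fst
  have hw : Tendsto (fun q : P × E => q.2) (l ×ˢ 𝓝 v) (𝓝 v) := tendsto_snd
  have t1 := tendsto_apply_apply hB' hw hw
  have t2 := tendsto_apply_apply hB' hw hX'
  exact (t1.eventually (gt_mem_nhds hv)).and
    ((t2.eventually (gt_mem_nhds hvX)).and (t1.neg.sqrt.eventually (lt_mem_nhds hc)))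

end LorentzPerturbation

/-! ### Velocities and the metric in a chart -/

section Charts

variable {d : ℕ} {M : Type*} [TopologicalSpace M]
  [ChartedSpace (EuclideanSpace ℝ (Fin (d + 1))) M] [IsManifold (𝓡 (d + 1)) ∞ M]

/-- The coordinates at `p`, in the chart at `x₀`, of a tangent vector. -/
noncomputable def coordVector (x₀ p : M) :
    TangentSpace (𝓡 (d + 1)) p →L[ℝ] EuclideanSpace ℝ (Fin (d + 1)) :=
  (trivializationAt (EuclideanSpace ℝ (Fin (d + 1))) (TangentSpace (𝓡 (d + 1))) x₀).continuousLinearMapAt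
    ℝ p

lemma mem_tangent_baseSet {x₀ p : M} (hp : p ∈ (extChartAt (𝓡 (d + 1)) x₀).source) :
    p ∈ (trivializationAt (EuclideanSpace ℝ (Fin (d + 1)))
      (TangentSpace (𝓡 (d + 1)) : M → Type _) x₀).baseSet := by
  rw [extChartAt_source] at hp
  simpa using hp

lemma mdifferentiableAt_of_chart {σ : ℝ → M} {t : ℝ} {x₀ : M} (hc : ContinuousAt σ t)
    (hs : σ t ∈ (extChartAt (𝓡 (d + 1)) x₀).source)
    (hd : DifferentiableAt ℝ (extChartAt (𝓡 (d + 1)) x₀ ∘ σ) t) :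
    MDifferentiableAt 𝓘(ℝ, ℝ) (𝓡 (d + 1)) σ t := by
  have h1 : MDifferentiableAt 𝓘(ℝ, EuclideanSpace ℝ (Fin (d + 1))) (𝓡 (d + 1))
      (extChartAt (𝓡 (d + 1)) x₀).symm ((extChartAt (𝓡 (d + 1)) x₀) (σ t)) := by
    have := mdifferentiableWithinAt_extChartAt_symm (I := 𝓡 (d + 1))
      ((extChartAt (𝓡 (d + 1)) x₀).map_source hs)
    rw [ModelWithCorners.range_eq_univ] at this
    exact mdifferentiableWithinAt_univ.1 this
  have h2 : MDifferentiableAt 𝓘(ℝ, ℝ) (𝓡 (d + 1))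
      ((extChartAt (𝓡 (d + 1)) x₀).symm ∘ (extChartAt (𝓡 (d + 1)) x₀ ∘ σ)) t :=
    MDifferentiableAt.comp t h1 hd.mdifferentiableAt
  refine h2.congr_of_eventuallyEq ?_
  filter_upwards [hc.eventually ((isOpen_extChartAt_source x₀).mem_nhds hs)] with s hs'
  exact ((extChartAt (𝓡 (d + 1)) x₀).left_inv hs').symm

/-- No differentiability is needed: where it fails, it fails for the chart expression too by
`mdifferentiableAt_of_chart`, and both sides are zero. -/
lemma deriv_chart_comp {σ : ℝ → M} {t : ℝ} {x₀ : M} (hc : ContinuousAt σ t)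
    (hs : σ t ∈ (extChartAt (𝓡 (d + 1)) x₀).source) :
    deriv (extChartAt (𝓡 (d + 1)) x₀ ∘ σ) t =
      coordVector x₀ (σ t) (mfderiv 𝓘(ℝ, ℝ) (𝓡 (d + 1)) σ t (1 : ℝ)) := by
  have hs' : σ t ∈ (chartAt (EuclideanSpace ℝ (Fin (d + 1))) x₀).source := by
    rwa [extChartAt_source] at hs
  by_cases h : MDifferentiableAt 𝓘(ℝ, ℝ) (𝓡 (d + 1)) σ t
  · unfold coordVector
    rw [TangentBundle.continuousLinearMapAt_trivializationAt hs']
    have h1 := mfderiv_comp t (mdifferentiableAt_extChartAt (I := 𝓡 (d + 1)) hs') h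
    rw [mfderiv_eq_fderiv] at h1
    have h2 := congrArg (fun f => f (1 : ℝ)) h1
    exact h2
  · rw [mfderiv_zero_of_not_mdifferentiableAt h, deriv_zero_of_not_differentiableAt]
    · exact (map_zero (coordVector x₀ (σ t))).symm
    · exact fun hd => h (mdifferentiableAt_of_chart hc hs hd)

lemma symmL_coordVector {x₀ p : M} (hp : p ∈ (extChartAt (𝓡 (d + 1)) x₀).source)
    (v : TangentSpace (𝓡 (d + 1)) p) :
    (trivializationAt (EuclideanSpace ℝ (Fin (d + 1))) (TangentSpace (𝓡 (d + 1))) x₀).symm p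
      (coordVector x₀ p v) = v :=
  (Trivialization.symmL_apply (R := ℝ) _ (mem_tangent_baseSet hp) _).symm.trans
    (Trivialization.symmL_continuousLinearMapAt (R := ℝ) _ (mem_tangent_baseSet hp) v)

namespace ContinuousSpacetime

variable (S : ContinuousSpacetime d M)

/-- The metric in the coordinates of the chart at `x₀`. -/
noncomputable def coordMetric (x₀ p : M) : EuclideanSpace ℝ (Fin (d + 1)) →L[ℝ]
    EuclideanSpace ℝ (Fin (d + 1)) →L[ℝ] ℝ :=
  ContinuousLinearMap.inCoordinates (EuclideanSpace ℝ (Fin (d + 1))) (TangentSpace (𝓡 (d + 1)))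
    (EuclideanSpace ℝ (Fin (d + 1)) →L[ℝ] ℝ)
    (fun x : M => TangentSpace (𝓡 (d + 1)) x →L[ℝ] ℝ) x₀ p x₀ p (S.g p)

lemma coordMetric_apply {x₀ p : M} (hp : p ∈ (extChartAt (𝓡 (d + 1)) x₀).source)
    (v w : TangentSpace (𝓡 (d + 1)) p) :
    S.coordMetric x₀ p (coordVector x₀ p v) (coordVector x₀ p w) = S.g p v w := by
  unfold coordMetric
  have := inCoordinates_apply_eq₂ (𝕜 := ℝ) (F₁ := EuclideanSpace ℝ (Fin (d + 1)))
    (E₁ := (TangentSpace (𝓡 (d + 1)) : M → Type _)) (F₂ := EuclideanSpace ℝ (Fin (d + 1)))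
    (E₂ := (TangentSpace (𝓡 (d + 1)) : M → Type _)) (F₃ := ℝ) (E₃ := Bundle.Trivial M ℝ)
    (x₀ := x₀) (x := p) (ϕ := S.g p) (v := coordVector x₀ p v) (w := coordVector x₀ p w)
    (mem_tangent_baseSet hp) (mem_tangent_baseSet hp) (by simp)
  rw [symmL_coordVector hp, symmL_coordVector hp] at this
  refine Eq.trans this ?_
  simp

lemma continuousAt_coordMetric (x₀ : M) : ContinuousAt (S.coordMetric x₀) x₀ := by
  have := S.continuous_g.continuousAt (x := x₀)
  exact ((continuousAt_hom_bundle (σ := RingHom.id ℝ) _).1 this).2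

lemma continuousAt_coordField (x₀ : M) :
    ContinuousAt (fun p => coordVector x₀ p (S.timeField p)) x₀ := by
  have h1 := ((FiberBundle.continuousAt_totalSpace (EuclideanSpace ℝ (Fin (d + 1))) _).1
    (S.continuous_timeField.continuousAt (x := x₀))).2
  refine h1.congr ?_
  filter_upwards [(isOpen_extChartAt_source (I := 𝓡 (d + 1)) x₀).mem_nhds
    (mem_extChartAt_source x₀)] with p hp
  unfold coordVector
  rw [Trivialization.continuousLinearMapAt_apply, Trivialization.linearMapAt_apply,
    if_pos (mem_tangent_baseSet hp)]

lemma isLorentzianForm_coordMetric {x₀ p : M} (hp : p ∈ (extChartAt (𝓡 (d + 1)) x₀).source) :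
    IsLorentzianForm (S.coordMetric x₀ p) := by
  let e := (trivializationAt (EuclideanSpace ℝ (Fin (d + 1)))
    (TangentSpace (𝓡 (d + 1)) : M → Type _) x₀).continuousLinearEquivAt ℝ p (mem_tangent_baseSet hp)
  have he : ∀ v, coordVector x₀ p v = e v := by
    intro v
    have := (trivializationAt (EuclideanSpace ℝ (Fin (d + 1)))
      (TangentSpace (𝓡 (d + 1)) : M → Type _) x₀).coe_continuousLinearEquivAt_eq (R := ℝ)
      (mem_tangent_baseSet hp)
    exact (congrFun this v).symm
  obtain ⟨b, hb⟩ := S.signature p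
  refine isLorentzianForm_of_basis (d := d) (fun v w => ?_) (b.map e.toLinearEquiv) fun i j => ?_
  · obtain ⟨v, rfl⟩ := e.surjective v
    obtain ⟨w, rfl⟩ := e.surjective w
    rw [← he, ← he, S.coordMetric_apply hp, S.coordMetric_apply hp, S.symm]
  · rw [← hb i j, ← S.coordMetric_apply hp, he, he]
    rfl

end ContinuousSpacetime

end Charts

/-! ### Lipschitz curves on intervals -/

/-- Concatenation of curves. -/
noncomputable def glueCurve {Y : Type*} (σ τ : ℝ → Y) (b : ℝ) (t : ℝ) : Y := if t ≤ b then σ t else τ t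

lemma glueCurve_eqOn_left {Y : Type*} (σ τ : ℝ → Y) (b : ℝ) : EqOn (glueCurve σ τ b) σ (Iic b) :=
  fun _ ht => if_pos ht

lemma glueCurve_eqOn_right {Y : Type*} {σ τ : ℝ → Y} {b : ℝ} (h : σ b = τ b) :
    EqOn (glueCurve σ τ b) τ (Ici b) := by
  intro t ht
  rcases (show b ≤ t from ht).eq_or_lt with rfl | h'
  · exact (if_pos le_rfl).trans h
  · exact if_neg (not_le.2 h')

section LipschitzCurves

variable {d : ℕ} {M : Type*} [TopologicalSpace M]
  [ChartedSpace (EuclideanSpace ℝ (Fin (d + 1))) M]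

variable (d) in
/-- The curve `σ` is Lipschitz in charts, near every time of `s`. -/
def IsLipschitzCurveOn (σ : ℝ → M) (s : Set ℝ) : Prop :=
  ContinuousOn σ s ∧
    ∀ t ∈ s, ∃ K : ℝ≥0, ∃ U ∈ 𝓝[s] t,
      MapsTo σ U (extChartAt (𝓡 (d + 1)) (σ t)).source ∧
      LipschitzOnWith K (extChartAt (𝓡 (d + 1)) (σ t) ∘ σ) U

lemma IsLipschitzCurveOn.mono {σ : ℝ → M} {s s' : Set ℝ} (h : IsLipschitzCurveOn d σ s)
    (hs : s' ⊆ s) : IsLipschitzCurveOn d σ s' :=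
  ⟨h.1.mono hs, fun t ht => by
    obtain ⟨K, U, hU, h1, h2⟩ := h.2 t (hs ht)
    exact ⟨K, U, nhdsWithin_mono _ hs hU, h1, h2⟩⟩

lemma IsLipschitzCurve.isAbsolutelyContinuousCurve {σ : ℝ → M} (h : IsLipschitzCurve d σ) :
    IsAbsolutelyContinuousCurve d σ := by
  refine ⟨h.1, fun t ht => ?_⟩
  obtain ⟨K, U, hU, h1, h2⟩ := h.2 t ht
  obtain ⟨ε, hε, hεU⟩ := Metric.mem_nhdsWithin_iff.1 hU
  have hsub : Icc (max 0 (t - ε / 2)) (min 1 (t + ε / 2)) ⊆ U := by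
    intro x hx
    have hx1 := max_le_iff.1 hx.1
    have hx2 := le_min_iff.1 hx.2
    refine hεU ⟨?_, hx1.1, hx2.1⟩
    rw [Metric.mem_ball, Real.dist_eq, abs_lt]
    constructor <;> linarith
  have hlt : max 0 (t - ε / 2) < min 1 (t + ε / 2) := by
    have := ht.1; have := ht.2
    rw [max_lt_iff, lt_min_iff, lt_min_iff]
    exact ⟨⟨one_pos, by linarith⟩, by linarith, by linarith⟩
  refine ⟨max 0 (t - ε / 2), min 1 (t + ε / 2), hlt,
    Icc_subset_Icc (le_max_left _ _) (min_le_left _ _), ?_, fun x hx => h1 (hsub hx), ?_⟩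
  · refine Metric.mem_nhdsWithin_iff.2 ⟨ε / 2, half_pos hε, fun x hx => ?_⟩
    have h3 := hx.1
    rw [Metric.mem_ball, Real.dist_eq, abs_lt] at h3
    exact ⟨max_le hx.2.1 (by linarith), le_min hx.2.2 (by linarith)⟩
  · refine LipschitzOnWith.absolutelyContinuousOnInterval (K := K) ?_
    rw [uIcc_of_le hlt.le]
    exact h2.mono hsub

lemma LipschitzOnWith.of_eqOn {X Y : Type*} [PseudoEMetricSpace X] [PseudoEMetricSpace Y]
    {f g : X → Y} {K : ℝ≥0} {s : Set X} (hf : LipschitzOnWith K f s) (h : EqOn g f s) :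
    LipschitzOnWith K g s :=
  fun x hx y hy => by rw [h hx, h hy]; exact hf hx hy

lemma exists_lipschitzOnWith_glue {E : Type*} [PseudoEMetricSpace E] {f : ℝ → E} {b : ℝ}
    {K₁ K₂ : ℝ≥0} {U : Set ℝ} (hb : b ∈ U) (h1 : LipschitzOnWith K₁ f (U ∩ Iic b))
    (h2 : LipschitzOnWith K₂ f (U ∩ Ici b)) : LipschitzOnWith (max K₁ K₂) f U := by
  have h1' := h1.weaken (le_max_left K₁ K₂)
  have h2' := h2.weaken (le_max_right K₁ K₂)
  have key : ∀ x ∈ U, ∀ y ∈ U, x ≤ y → edist (f x) (f y) ≤ (max K₁ K₂ : ℝ≥0) * edist x y := by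
    intro x hx y hy hxy
    rcases le_total y b with hyb | hyb
    · exact h1' ⟨hx, hxy.trans hyb⟩ ⟨hy, hyb⟩
    rcases le_total x b with hxb | hxb
    · calc edist (f x) (f y) ≤ edist (f x) (f b) + edist (f b) (f y) := edist_triangle _ _ _
        _ ≤ (max K₁ K₂ : ℝ≥0) * edist x b + (max K₁ K₂ : ℝ≥0) * edist b y :=
          add_le_add (h1' ⟨hx, hxb⟩ ⟨hb, le_refl b⟩) (h2' ⟨hb, le_refl b⟩ ⟨hy, hyb⟩)
        _ = (max K₁ K₂ : ℝ≥0) * edist x y := by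
          rw [← mul_add, edist_dist, edist_dist, edist_dist,
            ← ENNReal.ofReal_add dist_nonneg dist_nonneg, Real.dist_eq, Real.dist_eq, Real.dist_eq,
            abs_of_nonpos (by linarith), abs_of_nonpos (by linarith), abs_of_nonpos (by linarith)]
          congr 2; ring
    · exact h2' ⟨hx, hxb⟩ ⟨hy, hyb⟩
  intro x hx y hy
  rcases le_total x y with h | h
  · exact key x hx y hy h
  · rw [edist_comm (f x), edist_comm x]; exact key y hy x hx h

lemma isLipschitzCurveOn_congr {σ τ : ℝ → M} {s : Set ℝ} (h : IsLipschitzCurveOn d σ s)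
    (hst : EqOn τ σ s) : IsLipschitzCurveOn d τ s := by
  refine ⟨h.1.congr hst, fun t ht => ?_⟩
  obtain ⟨K, U, hU, h1, h2⟩ := h.2 t ht
  refine ⟨K, U ∩ s, inter_mem hU self_mem_nhdsWithin, fun x hx => ?_, ?_⟩
  · rw [hst hx.2, hst ht]; exact h1 hx.1
  · refine LipschitzOnWith.of_eqOn (h2.mono inter_subset_left) fun x hx => ?_
    simp only [Function.comp, hst hx.2, hst ht]

lemma isLipschitzCurveOn_Icc_of_left_of_right {σ : ℝ → M} {a b c : ℝ} (hab : a ≤ b) (hbc : b ≤ c)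
    (h1 : IsLipschitzCurveOn d σ (Icc a b)) (h2 : IsLipschitzCurveOn d σ (Icc b c)) :
    IsLipschitzCurveOn d σ (Icc a c) := by
  refine ⟨?_, fun t ht => ?_⟩
  · rw [← Icc_union_Icc_eq_Icc hab hbc]
    exact h1.1.union_of_isClosed h2.1 isClosed_Icc isClosed_Icc
  rcases lt_trichotomy t b with htb | rfl | htb
  · obtain ⟨K, U, hU, h3, h4⟩ := h1.2 t ⟨ht.1, htb.le⟩
    refine ⟨K, U, ?_, h3, h4⟩
    have : 𝓝[Icc a c] t = 𝓝[Icc a b] t := by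
      refine nhdsWithin_eq_nhdsWithin (mem_Iio.2 htb) isOpen_Iio ?_
      ext x
      simp only [mem_inter_iff, mem_Icc, mem_Iio]
      constructor
      · rintro ⟨⟨h, -⟩, h'⟩; exact ⟨⟨h, h'.le⟩, h'⟩
      · rintro ⟨⟨h, -⟩, h'⟩; exact ⟨⟨h, h'.le.trans hbc⟩, h'⟩
    rwa [this]
  · obtain ⟨K₁, U₁, hU₁, h3, h4⟩ := h1.2 t ⟨ht.1, le_rfl⟩
    obtain ⟨K₂, U₂, hU₂, h5, h6⟩ := h2.2 t ⟨le_rfl, ht.2⟩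
    obtain ⟨ε₁, hε₁, hU₁'⟩ := Metric.mem_nhdsWithin_iff.1 hU₁
    obtain ⟨ε₂, hε₂, hU₂'⟩ := Metric.mem_nhdsWithin_iff.1 hU₂
    have hl : Metric.ball t (min ε₁ ε₂) ∩ Icc a c ∩ Iic t ⊆ U₁ := fun x hx =>
      hU₁' ⟨Metric.ball_subset_ball (min_le_left _ _) hx.1.1, hx.1.2.1, hx.2⟩
    have hr : Metric.ball t (min ε₁ ε₂) ∩ Icc a c ∩ Ici t ⊆ U₂ := fun x hx =>
      hU₂' ⟨Metric.ball_subset_ball (min_le_right _ _) hx.1.1, hx.2, hx.1.2.2⟩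
    have hpos : 0 < min ε₁ ε₂ := lt_min hε₁ hε₂
    refine ⟨max K₁ K₂, Metric.ball t (min ε₁ ε₂) ∩ Icc a c,
      inter_mem (nhdsWithin_le_nhds (Metric.ball_mem_nhds t hpos)) self_mem_nhdsWithin, ?_, ?_⟩
    · intro x hx
      rcases le_total x t with h | h
      · exact h3 (hl ⟨hx, h⟩)
      · exact h5 (hr ⟨hx, h⟩)
    · exact exists_lipschitzOnWith_glue ⟨Metric.mem_ball_self hpos, ht⟩ (h4.mono hl) (h6.mono hr)
  · obtain ⟨K, U, hU, h3, h4⟩ := h2.2 t ⟨htb.le, ht.2⟩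
    refine ⟨K, U, ?_, h3, h4⟩
    have : 𝓝[Icc a c] t = 𝓝[Icc b c] t := by
      refine nhdsWithin_eq_nhdsWithin (mem_Ioi.2 htb) isOpen_Ioi ?_
      ext x
      simp only [mem_inter_iff, mem_Icc, mem_Ioi]
      constructor
      · rintro ⟨⟨-, h⟩, h'⟩; exact ⟨⟨h'.le, h⟩, h'⟩
      · rintro ⟨⟨-, h⟩, h'⟩; exact ⟨⟨hab.trans h'.le, h⟩, h'⟩
    rwa [this]

lemma IsLipschitzCurveOn.glueCurve {σ τ : ℝ → M} {a b c : ℝ} (hab : a ≤ b) (hbc : b ≤ c)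
    (h1 : IsLipschitzCurveOn d σ (Icc a b)) (h2 : IsLipschitzCurveOn d τ (Icc b c))
    (h : σ b = τ b) : IsLipschitzCurveOn d (glueCurve σ τ b) (Icc a c) :=
  isLipschitzCurveOn_Icc_of_left_of_right hab hbc
    (isLipschitzCurveOn_congr h1 ((glueCurve_eqOn_left σ τ b).mono fun _ hx => hx.2))
    (isLipschitzCurveOn_congr h2 ((glueCurve_eqOn_right h).mono fun _ hx => hx.1))

/-- Reparametrization by an affine map. -/
lemma IsLipschitzCurveOn.comp_affine {σ : ℝ → M} {a b m c : ℝ} {s : Set ℝ}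
    (h : IsLipschitzCurveOn d σ (Icc a b)) (hs : MapsTo (fun r => m + r * c) s (Icc a b)) :
    IsLipschitzCurveOn d (fun r => σ (m + r * c)) s := by
  have hcont : Continuous fun r : ℝ => m + r * c := by fun_prop
  have hlip : LipschitzWith ‖c‖₊ fun r : ℝ => m + r * c := by
    refine LipschitzWith.of_dist_le_mul fun x y => ?_
    rw [Real.dist_eq, Real.dist_eq, coe_nnnorm, Real.norm_eq_abs, ← abs_mul]
    refine le_of_eq (congrArg _ ?_); ring
  refine ⟨h.1.comp hcont.continuousOn hs, fun t ht => ?_⟩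
  obtain ⟨K, U, hU, h1, h2⟩ := h.2 _ (hs ht)
  refine ⟨K * ‖c‖₊, (fun r => m + r * c) ⁻¹' U,
    (hcont.continuousWithinAt.tendsto_nhdsWithin hs) hU, fun x hx => h1 hx, ?_⟩
  exact h2.comp hlip.lipschitzOnWith (fun x hx => hx)

variable [IsManifold (𝓡 (d + 1)) ∞ M]

/-- Being Lipschitz does not depend on the chart. -/
lemma exists_lipschitzOnWith_change_chart {σ : ℝ → M} {s : Set ℝ} {t : ℝ} {x₀ x₁ : M}
    (hc : ContinuousWithinAt σ s t) (h0 : σ t ∈ (extChartAt (𝓡 (d + 1)) x₀).source)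
    (h1 : σ t ∈ (extChartAt (𝓡 (d + 1)) x₁).source)
    (hL : ∃ K : ℝ≥0, ∃ U ∈ 𝓝[s] t, LipschitzOnWith K (extChartAt (𝓡 (d + 1)) x₀ ∘ σ) U) :
    ∃ K : ℝ≥0, ∃ U ∈ 𝓝[s] t, MapsTo σ U (extChartAt (𝓡 (d + 1)) x₁).source ∧
      LipschitzOnWith K (extChartAt (𝓡 (d + 1)) x₁ ∘ σ) U := by
  obtain ⟨K, U, hU, hKU⟩ := hL
  have hmem : extChartAt (𝓡 (d + 1)) x₀ (σ t) ∈
      ((extChartAt (𝓡 (d + 1)) x₀).symm ≫ extChartAt (𝓡 (d + 1)) x₁).source := by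
    rw [PartialEquiv.trans_source, PartialEquiv.symm_source]
    refine ⟨(extChartAt (𝓡 (d + 1)) x₀).map_source h0, ?_⟩
    rw [mem_preimage, (extChartAt (𝓡 (d + 1)) x₀).left_inv h0]
    exact h1
  -- The transition map is `C¹`, hence Lipschitz near the point.
  have hdiff := contDiffWithinAt_ext_coord_change (I := 𝓡 (d + 1)) (n := 1) x₁ x₀ hmem
  rw [ModelWithCorners.range_eq_univ, contDiffWithinAt_univ] at hdiff
  obtain ⟨K', V, hV, hK'⟩ := hdiff.exists_lipschitzOnWith
  have hc0 : ContinuousWithinAt (extChartAt (𝓡 (d + 1)) x₀ ∘ σ) s t :=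
    (continuousAt_extChartAt' h0).comp_continuousWithinAt hc
  have e1 : σ ⁻¹' (extChartAt (𝓡 (d + 1)) x₀).source ∈ 𝓝[s] t :=
    hc ((isOpen_extChartAt_source x₀).mem_nhds h0)
  have e2 : σ ⁻¹' (extChartAt (𝓡 (d + 1)) x₁).source ∈ 𝓝[s] t :=
    hc ((isOpen_extChartAt_source x₁).mem_nhds h1)
  have e3 : (extChartAt (𝓡 (d + 1)) x₀ ∘ σ) ⁻¹' V ∈ 𝓝[s] t := hc0 hV
  refine ⟨K' * K, U ∩ (σ ⁻¹' (extChartAt (𝓡 (d + 1)) x₀).source ∩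
    (σ ⁻¹' (extChartAt (𝓡 (d + 1)) x₁).source ∩ (extChartAt (𝓡 (d + 1)) x₀ ∘ σ) ⁻¹' V)),
    inter_mem hU (inter_mem e1 (inter_mem e2 e3)), fun x hx => hx.2.2.1, ?_⟩
  refine LipschitzOnWith.of_eqOn
    (hK'.comp (hKU.mono inter_subset_left) (fun x hx => hx.2.2.2)) fun x hx => ?_
  simp only [Function.comp]
  rw [(extChartAt (𝓡 (d + 1)) x₀).left_inv hx.2.1]

lemma IsLipschitzCurveOn.exists_lipschitzOnWith_chart {σ : ℝ → M} {a b : ℝ} {x₀ : M}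
    (h : IsLipschitzCurveOn d σ (Icc a b))
    (hs : MapsTo σ (Icc a b) (extChartAt (𝓡 (d + 1)) x₀).source) :
    ∃ K, LipschitzOnWith K (extChartAt (𝓡 (d + 1)) x₀ ∘ σ) (Icc a b) := by
  refine LocallyLipschitzOn.exists_lipschitzOnWith_of_compact isCompact_Icc fun t ht => ?_
  obtain ⟨K, U, hU, -, h2⟩ := h.2 t ht
  obtain ⟨K', U', hU', -, h3⟩ := exists_lipschitzOnWith_change_chart (h.1 t ht)
    (mem_extChartAt_source (σ t)) (hs ht) ⟨K, U, hU, h2⟩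
  exact ⟨K', U', hU', h3⟩

lemma isLipschitzCurveOn_of_chart {σ : ℝ → M} {s : Set ℝ} {x₀ : M} {K : ℝ≥0}
    (hc : ContinuousOn σ s) (hs : MapsTo σ s (extChartAt (𝓡 (d + 1)) x₀).source)
    (hL : LipschitzOnWith K (extChartAt (𝓡 (d + 1)) x₀ ∘ σ) s) : IsLipschitzCurveOn d σ s :=
  ⟨hc, fun t ht => exists_lipschitzOnWith_change_chart (hc t ht) (hs ht)
    (mem_extChartAt_source (σ t)) ⟨K, s, self_mem_nhdsWithin, hL⟩⟩

end LipschitzCurves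

/-! ### Causal curves on intervals and the time separation -/

lemma restrict_Ioo_eq_add {a b c : ℝ} (hab : a ≤ b) (hbc : b ≤ c) :
    (volume.restrict (Ioo a c) : Measure ℝ) =
      volume.restrict (Ioo a b) + volume.restrict (Ioo b c) := by
  rw [restrict_Ioo_eq_restrict_Ioc, restrict_Ioo_eq_restrict_Ioc, restrict_Ioo_eq_restrict_Ioc,
    ← Ioc_union_Ioc_eq_Ioc hab hbc, Measure.restrict_union (Ioc_disjoint_Ioc_of_le le_rfl)
      measurableSet_Ioc]

section CausalCurves

variable {d : ℕ} {M : Type*} [TopologicalSpace M]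
  [ChartedSpace (EuclideanSpace ℝ (Fin (d + 1))) M]

/-- The two-sided derivative of a curve. -/
noncomputable def curveVelocity (σ : ℝ → M) (t : ℝ) : TangentSpace (𝓡 (d + 1)) (σ t) :=
  mfderiv 𝓘(ℝ, ℝ) (𝓡 (d + 1)) σ t (1 : ℝ)

lemma velocity_eq_curveVelocity {σ : ℝ → M} {t : ℝ} (ht : t ∈ Ioo (0 : ℝ) 1) :
    velocity (d := d) σ t = curveVelocity σ t := by
  unfold velocity curveVelocity
  rw [mfderivWithin_of_mem_nhds (Icc_mem_nhds ht.1 ht.2)]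

/-- The two velocities have different types even where the curves agree, so their equality is
expressed by transporting an arbitrary predicate of the point and the vector. -/
lemma curveVelocity_congr {σ τ : ℝ → M} {t : ℝ} (h : σ =ᶠ[𝓝 t] τ)
    (Q : ∀ x : M, TangentSpace (𝓡 (d + 1)) x → Prop) (hQ : Q (σ t) (curveVelocity σ t)) :
    Q (τ t) (curveVelocity τ t) := by
  have h1 : τ t = σ t := h.eq_of_nhds.symm
  have h2 : (curveVelocity (d := d) τ t : EuclideanSpace ℝ (Fin (d + 1))) =
      (curveVelocity (d := d) σ t : EuclideanSpace ℝ (Fin (d + 1))) := by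
    unfold curveVelocity
    have := h.mfderiv_eq (I := 𝓘(ℝ, ℝ)) (I' := 𝓡 (d + 1))
    exact congrArg (fun f => f (1 : ℝ)) this.symm
  have key : ∀ (y : M) (w : EuclideanSpace ℝ (Fin (d + 1))), y = σ t →
      w = (curveVelocity (d := d) σ t : EuclideanSpace ℝ (Fin (d + 1))) → Q y w := by
    rintro y w rfl rfl
    exact hQ
  exact key _ _ h1 h2

lemma curveVelocity_glue_left (σ τ : ℝ → M) {a b t : ℝ} (ht : t ∈ Ioo a b)
    (Q : ∀ x : M, TangentSpace (𝓡 (d + 1)) x → Prop) (hQ : Q (σ t) (curveVelocity σ t)) :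
    Q (glueCurve σ τ b t) (curveVelocity (glueCurve σ τ b) t) :=
  curveVelocity_congr (((glueCurve_eqOn_left σ τ b).eventuallyEq_of_mem
    (Iic_mem_nhds ht.2)).symm) Q hQ

lemma curveVelocity_glue_right {σ τ : ℝ → M} {b c t : ℝ} (h : σ b = τ b) (ht : t ∈ Ioo b c)
    (Q : ∀ x : M, TangentSpace (𝓡 (d + 1)) x → Prop) (hQ : Q (τ t) (curveVelocity τ t)) :
    Q (glueCurve σ τ b t) (curveVelocity (glueCurve σ τ b) t) :=
  curveVelocity_congr (((glueCurve_eqOn_right h).eventuallyEq_of_mem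
    (Ici_mem_nhds ht.1)).symm) Q hQ

lemma mdifferentiableAt_affine (m c r : ℝ) :
    MDifferentiableAt 𝓘(ℝ, ℝ) 𝓘(ℝ, ℝ) (fun r : ℝ => m + r * c) r :=
  DifferentiableAt.mdifferentiableAt (by fun_prop)

lemma curveVelocity_comp_affine {σ : ℝ → M} {m c : ℝ} (hc : c ≠ 0) (r : ℝ) :
    curveVelocity (d := d) (fun r => σ (m + r * c)) r =
      c • (curveVelocity (d := d) σ (m + r * c) : TangentSpace (𝓡 (d + 1)) (σ (m + r * c))) := by
  by_cases h : MDifferentiableAt 𝓘(ℝ, ℝ) (𝓡 (d + 1)) σ (m + r * c)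
  · have h1 := mfderiv_comp (I := 𝓘(ℝ, ℝ)) (I' := 𝓘(ℝ, ℝ)) (I'' := 𝓡 (d + 1)) (g := σ)
      (f := fun r : ℝ => m + r * c) r h (mdifferentiableAt_affine m c r)
    have h2 : mfderiv 𝓘(ℝ, ℝ) 𝓘(ℝ, ℝ) (fun r : ℝ => m + r * c) r (1 : ℝ) = c := by
      rw [mfderiv_eq_fderiv]
      have : HasDerivAt (fun r : ℝ => m + r * c) c r := by
        simpa using ((hasDerivAt_id r).mul_const c).const_add m
      have h3 : fderiv ℝ (fun r : ℝ => m + r * c) r (1 : ℝ) = deriv (fun r : ℝ => m + r * c) r :=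
        fderiv_apply_one_eq_deriv
      exact h3.trans this.deriv
    have h4 := congrArg (fun f => f (1 : ℝ)) h1
    refine Eq.trans h4 ?_
    refine Eq.trans (congrArg (mfderiv 𝓘(ℝ, ℝ) (𝓡 (d + 1)) σ (m + r * c)) h2) ?_
    have h5 : (c : ℝ) = c • (1 : ℝ) := by simp
    unfold curveVelocity
    refine Eq.trans (congrArg (mfderiv 𝓘(ℝ, ℝ) (𝓡 (d + 1)) σ (m + r * c)) h5) ?_
    exact map_smul (mfderiv 𝓘(ℝ, ℝ) (𝓡 (d + 1)) σ (m + r * c)) c (1 : ℝ)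
  -- The reparametrization is invertible, so non-differentiability passes to the composite and both
  -- velocities are zero.
  · have h' : ¬ MDifferentiableAt 𝓘(ℝ, ℝ) (𝓡 (d + 1)) (fun r => σ (m + r * c)) r := by
      intro h'
      apply h
      have e : (fun r => σ (m + r * c)) ∘ (fun s : ℝ => -m / c + s * c⁻¹) = σ := by
        funext s
        simp only [Function.comp]
        congr 1; field_simp; ring
      have h3 : -m / c + (m + r * c) * c⁻¹ = r := by field_simp; ring
      rw [← e]
      exact MDifferentiableAt.comp_of_eq _ h' (mdifferentiableAt_affine (-m / c) c⁻¹ _) h3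
    unfold curveVelocity
    rw [mfderiv_zero_of_not_mdifferentiableAt h, mfderiv_zero_of_not_mdifferentiableAt h']
    exact (smul_zero c).symm

namespace ContinuousSpacetime

variable [IsManifold (𝓡 (d + 1)) ∞ M] (S : ContinuousSpacetime d M)

/-- The zero vector and the future directed causal vectors. -/
def InFuture {x : M} (v : TangentSpace (𝓡 (d + 1)) x) : Prop := v = 0 ∨ S.IsFutureDirected v

lemma InFuture.smul {x : M} {v : TangentSpace (𝓡 (d + 1)) x} (h : S.InFuture v) {c : ℝ}
    (hc : 0 < c) : S.InFuture (c • v) := by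
  rcases h with rfl | ⟨h1, h2⟩
  · exact Or.inl (smul_zero c)
  · refine Or.inr ⟨?_, ?_⟩
    · unfold IsCausalVector at *
      simp only [map_smul, smul_apply, smul_eq_mul]
      rcases h1 with h1 | ⟨h1, h3⟩
      · exact Or.inl (mul_neg_of_pos_of_neg hc (mul_neg_of_pos_of_neg hc h1))
      · exact Or.inr ⟨by rw [h1]; ring, smul_ne_zero hc.ne' h3⟩
    · simp only [map_smul, smul_apply, smul_eq_mul]
      exact mul_neg_of_pos_of_neg hc h2

lemma lorentzNorm_smul {x : M} (v : TangentSpace (𝓡 (d + 1)) x) {c : ℝ} (hc : 0 ≤ c) :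
    S.lorentzNorm (c • v) = c * S.lorentzNorm v := by
  unfold lorentzNorm
  simp only [map_smul, smul_apply, smul_eq_mul]
  rw [show -(c * (c * S.g x v v)) = c ^ 2 * -(S.g x v v) by ring, Real.sqrt_mul (sq_nonneg c),
    Real.sqrt_sq hc]

/-- Lipschitz future directed causal curves on `[a,b]`. -/
structure IsCausalCurveOn (σ : ℝ → M) (a b : ℝ) : Prop where
  lipschitz : IsLipschitzCurveOn d σ (Icc a b)
  future : ∀ᵐ t ∂(volume.restrict (Ioo a b)), S.InFuture (curveVelocity (d := d) σ t)

/-- The length of a curve on `[a,b]`. -/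
noncomputable def lengthOn (σ : ℝ → M) (a b : ℝ) : ℝ≥0∞ :=
  ∫⁻ t in Ioo a b, ENNReal.ofReal (S.lorentzNorm (curveVelocity (d := d) σ t))

variable {S}

lemma IsCausalCurveOn.mono {σ : ℝ → M} {a b a' b' : ℝ} (h : S.IsCausalCurveOn σ a b)
    (ha : a ≤ a') (hb : b' ≤ b) : S.IsCausalCurveOn σ a' b' :=
  ⟨h.lipschitz.mono (Icc_subset_Icc ha hb),
    ae_restrict_of_ae_restrict_of_subset (Ioo_subset_Ioo ha hb) h.future⟩

/-- The endpoints form a null set, so the one-sided derivatives there are irrelevant. -/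
lemma isCausalCurveOn_zero_one_iff {σ : ℝ → M} :
    S.IsCausalCurveOn σ 0 1 ↔ IsLipschitzCurve d σ ∧ S.IsClassicallyCausal σ := by
  have h : (∀ᵐ t ∂(volume.restrict (Icc (0 : ℝ) 1)),
      velocity (d := d) σ t = 0 ∨ S.IsFutureDirected (velocity (d := d) σ t)) ↔
      ∀ᵐ t ∂(volume.restrict (Ioo (0 : ℝ) 1)), S.InFuture (curveVelocity (d := d) σ t) := by
    rw [← restrict_Ioo_eq_restrict_Icc, ae_restrict_iff' measurableSet_Ioo,
      ae_restrict_iff' measurableSet_Ioo]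
    refine eventually_congr (Eventually.of_forall fun t => ?_)
    refine forall_congr' fun ht => ?_
    rw [velocity_eq_curveVelocity ht]; rfl
  constructor
  · rintro ⟨h1, h2⟩
    exact ⟨h1, IsLipschitzCurve.isAbsolutelyContinuousCurve h1, h.2 h2⟩
  · rintro ⟨h1, h2⟩
    exact ⟨h1, h.1 h2.2⟩

lemma lengthOn_zero_one (σ : ℝ → M) : S.lengthOn σ 0 1 = S.length σ := by
  unfold lengthOn length
  rw [← restrict_Ioo_eq_restrict_Icc]
  refine setLIntegral_congr_fun measurableSet_Ioo fun t ht => ?_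
  rw [velocity_eq_curveVelocity ht]

lemma IsCausalCurveOn.comp_affine {σ : ℝ → M} {a b : ℝ} (hab : a < b)
    (h : S.IsCausalCurveOn σ a b) :
    S.IsCausalCurveOn (fun r => σ (a + r * (b - a))) 0 1 := by
  have hc : 0 < b - a := sub_pos.2 hab
  refine ⟨h.lipschitz.comp_affine fun r hr => ⟨?_, ?_⟩, ?_⟩
  · have := mul_nonneg hr.1 hc.le; simp only; linarith
  · have := mul_le_mul_of_nonneg_right hr.2 hc.le; simp only; linarith
  have h2 := h.future
  rw [ae_restrict_iff' measurableSet_Ioo] at h2 ⊢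
  have hq : Measure.QuasiMeasurePreserving (fun r : ℝ => a + r * (b - a)) volume volume := by
    refine ⟨by fun_prop, Measure.AbsolutelyContinuous.mk fun s hs h0 => ?_⟩
    rw [Measure.map_apply (by fun_prop) hs]
    have : (fun r : ℝ => a + r * (b - a)) ⁻¹' s = (· * (b - a)) ⁻¹' ((a + ·) ⁻¹' s) := rfl
    rw [this, Real.volume_preimage_mul_right hc.ne', measure_preimage_add, h0, mul_zero]
  filter_upwards [hq.ae h2] with r hr hr01
  rw [curveVelocity_comp_affine hc.ne']
  refine InFuture.smul S (hr ⟨?_, ?_⟩) hc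
  · have := mul_pos hr01.1 hc; linarith
  · have := mul_lt_mul_of_pos_right hr01.2 hc; linarith

lemma lengthOn_comp_affine (σ : ℝ → M) {a b : ℝ} (hab : a < b) :
    S.lengthOn (fun r => σ (a + r * (b - a))) 0 1 = S.lengthOn σ a b := by
  have hc : 0 < b - a := sub_pos.2 hab
  have him : (fun r : ℝ => a + r * (b - a)) '' Ioo 0 1 = Ioo a b := by
    ext x
    constructor
    · rintro ⟨r, hr, rfl⟩
      have := mul_pos hr.1 hc
      have := mul_lt_mul_of_pos_right hr.2 hc
      exact ⟨by linarith, by linarith⟩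
    · intro hx
      refine ⟨(x - a) / (b - a), ⟨div_pos (by linarith [hx.1]) hc, ?_⟩, ?_⟩
      · rw [div_lt_one hc]; linarith [hx.2]
      · field_simp; ring
  unfold lengthOn
  rw [← him, lintegral_image_eq_lintegral_abs_deriv_mul measurableSet_Ioo
    (f' := fun _ => b - a)]
  · refine setLIntegral_congr_fun measurableSet_Ioo fun r _ => ?_
    dsimp only
    rw [curveVelocity_comp_affine hc.ne']
    erw [S.lorentzNorm_smul _ hc.le]
    rw [ENNReal.ofReal_mul hc.le, abs_of_pos hc]
  · intro r _
    have : HasDerivAt (fun r : ℝ => a + r * (b - a)) (b - a) r := by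
      simpa using ((hasDerivAt_id r).mul_const (b - a)).const_add a
    exact this.hasDerivWithinAt
  · intro x _ y _ hxy
    simpa [hc.ne'] using hxy

lemma IsCausalCurveOn.lengthOn_le_timeSeparation {σ : ℝ → M} {a b : ℝ} (hab : a < b)
    (h : S.IsCausalCurveOn σ a b) :
    ((S.lengthOn σ a b : ℝ≥0∞) : EReal) ≤ S.timeSeparation (σ a) (σ b) := by
  have h1 := isCausalCurveOn_zero_one_iff.1 (h.comp_affine hab)
  refine le_sSup ⟨_, h1.1, h1.2, by simp, by simp, ?_⟩
  rw [← lengthOn_zero_one, lengthOn_comp_affine σ hab]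

lemma IsCausalCurveOn.timeSeparation_nonneg {σ : ℝ → M} {a b : ℝ} (hab : a < b)
    (h : S.IsCausalCurveOn σ a b) : 0 ≤ S.timeSeparation (σ a) (σ b) :=
  le_trans (EReal.coe_ennreal_nonneg _) (h.lengthOn_le_timeSeparation hab)

lemma exists_causalCurve {x y : M} (h : 0 ≤ S.timeSeparation x y) :
    ∃ σ : ℝ → M, S.IsCausalCurveOn σ 0 1 ∧ σ 0 = x ∧ σ 1 = y := by
  have h1 : (⊥ : EReal) < S.timeSeparation x y := lt_of_lt_of_le EReal.bot_lt_zero h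
  obtain ⟨L, ⟨σ, h2, h3, h4, h5, -⟩, -⟩ := lt_sSup_iff.1 h1
  exact ⟨σ, isCausalCurveOn_zero_one_iff.2 ⟨h2, h3⟩, h4, h5⟩

/-- To bound the time separation, it suffices to bound the lengths of causal curves. -/
lemma toENNReal_timeSeparation_le {x y : M} {C : ℝ≥0∞}
    (h : ∀ σ : ℝ → M, S.IsCausalCurveOn σ 0 1 → σ 0 = x → σ 1 = y → S.lengthOn σ 0 1 ≤ C) :
    (S.timeSeparation x y).toENNReal ≤ C := by
  rw [← EReal.toENNReal_coe (x := C)]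
  refine EReal.toENNReal_le_toENNReal (sSup_le ?_)
  rintro L ⟨σ, h1, h2, h3, h4, rfl⟩
  rw [EReal.coe_ennreal_le_coe_ennreal_iff, ← lengthOn_zero_one]
  exact h σ (isCausalCurveOn_zero_one_iff.2 ⟨h1, h2⟩) h3 h4

lemma IsCausalCurveOn.lengthOn_le_toENNReal {σ : ℝ → M} {a b : ℝ} (hab : a < b)
    (h : S.IsCausalCurveOn σ a b) :
    S.lengthOn σ a b ≤ (S.timeSeparation (σ a) (σ b)).toENNReal := by
  have := EReal.toENNReal_le_toENNReal (h.lengthOn_le_timeSeparation hab)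
  rwa [EReal.toENNReal_coe] at this

lemma IsCausalCurveOn.glue {σ τ : ℝ → M} {a b c : ℝ} (hab : a ≤ b) (hbc : b ≤ c)
    (h1 : S.IsCausalCurveOn σ a b) (h2 : S.IsCausalCurveOn τ b c) (h : σ b = τ b) :
    S.IsCausalCurveOn (glueCurve σ τ b) a c := by
  refine ⟨h1.lipschitz.glueCurve hab hbc h2.lipschitz h, ?_⟩
  rw [restrict_Ioo_eq_add hab hbc, ae_add_measure_iff]
  constructor
  · filter_upwards [h1.future, ae_restrict_mem measurableSet_Ioo] with t ht ht'
    exact curveVelocity_glue_left σ τ ht' (fun x v => S.InFuture v) ht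
  · filter_upwards [h2.future, ae_restrict_mem measurableSet_Ioo] with t ht ht'
    exact curveVelocity_glue_right h ht' (fun x v => S.InFuture v) ht

lemma lengthOn_glue {σ τ : ℝ → M} {a b c : ℝ} (hab : a ≤ b) (hbc : b ≤ c) (h : σ b = τ b) :
    S.lengthOn (glueCurve σ τ b) a c = S.lengthOn σ a b + S.lengthOn τ b c := by
  unfold lengthOn
  rw [restrict_Ioo_eq_add hab hbc, lintegral_add_measure]
  congr 1
  · refine setLIntegral_congr_fun measurableSet_Ioo fun t ht => ?_
    exact curveVelocity_glue_left σ τ ht (fun x v => ENNReal.ofReal (S.lorentzNorm v) =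
      ENNReal.ofReal (S.lorentzNorm (curveVelocity (d := d) σ t))) rfl
  · refine setLIntegral_congr_fun measurableSet_Ioo fun t ht => ?_
    exact curveVelocity_glue_right h ht (fun x v => ENNReal.ofReal (S.lorentzNorm v) =
      ENNReal.ofReal (S.lorentzNorm (curveVelocity (d := d) τ t))) rfl

/-- Two causal curves parametrized by `[0,1]` can be concatenated to a causal curve
parametrized by `[0,2]`. -/
lemma exists_concatenation {σ τ : ℝ → M} (h1 : S.IsCausalCurveOn σ 0 1)
    (h2 : S.IsCausalCurveOn τ 0 1) (h : σ 1 = τ 0) :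
    ∃ ρ : ℝ → M, S.IsCausalCurveOn ρ 0 2 ∧ ρ 0 = σ 0 ∧ ρ 1 = σ 1 ∧ ρ 2 = τ 1 ∧
      S.lengthOn ρ 0 2 = S.lengthOn σ 0 1 + S.lengthOn τ 0 1 := by
  have hshift : (fun t : ℝ => τ (-1 + t * 1)) 1 = τ 0 := by simp
  have hfun : (fun r : ℝ => (fun t : ℝ => τ (-1 + t * 1)) (1 + r * (2 - 1))) = τ := by
    funext r; dsimp only; congr 1; ring
  have h3 : S.IsCausalCurveOn (fun t : ℝ => τ (-1 + t * 1)) 1 2 := by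
    refine ⟨h2.lipschitz.comp_affine fun r hr => ⟨?_, ?_⟩, ?_⟩
    · have := hr.1; simp only; linarith
    · have := hr.2; simp only; linarith
    have h4 := h2.future
    rw [ae_restrict_iff' measurableSet_Ioo] at h4 ⊢
    have hq : Measure.QuasiMeasurePreserving (fun r : ℝ => -1 + r * 1) volume volume := by
      simpa using (measurePreserving_add_left volume (-1 : ℝ)).quasiMeasurePreserving
    filter_upwards [hq.ae h4] with r hr hr12
    rw [curveVelocity_comp_affine one_ne_zero]
    refine InFuture.smul S (hr ⟨?_, ?_⟩) one_pos
    · linarith [hr12.1]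
    · linarith [hr12.2]
  have hm : σ 1 = (fun t : ℝ => τ (-1 + t * 1)) 1 := h.trans hshift.symm
  refine ⟨glueCurve σ (fun t : ℝ => τ (-1 + t * 1)) 1, h1.glue zero_le_one one_le_two h3 hm,
    by simp [glueCurve], by simp [glueCurve], ?_, ?_⟩
  · simp only [glueCurve, not_le.2 (one_lt_two (α := ℝ)), if_false]
    congr 1; norm_num
  · rw [lengthOn_glue zero_le_one one_le_two hm, ← lengthOn_comp_affine _ one_lt_two, hfun]

/-- Addition of `a` passes through the supremum over curves. The causality of the pair makes the
supremum nonempty, which gives `a ≤ C`; the value `a = ⊤` is separate because `a` is moved across by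
subtraction. -/
lemma add_toENNReal_timeSeparation_le {x y : M} {a C : ℝ≥0∞} (hxy : 0 ≤ S.timeSeparation x y)
    (h : ∀ σ : ℝ → M, S.IsCausalCurveOn σ 0 1 → σ 0 = x → σ 1 = y → a + S.lengthOn σ 0 1 ≤ C) :
    a + (S.timeSeparation x y).toENNReal ≤ C := by
  obtain ⟨σ₀, h0, h1, h2⟩ := exists_causalCurve hxy
  have haC : a ≤ C := le_self_add.trans (h σ₀ h0 h1 h2)
  by_cases ha : a = ⊤
  · rw [ha, top_add, ← ha]; exact haC
  · refine add_le_of_le_tsub_left_of_le haC (toENNReal_timeSeparation_le fun σ h3 h4 h5 => ?_)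
    exact ENNReal.le_sub_of_add_le_left ha (h σ h3 h4 h5)

/-- The reverse triangle inequality. -/
lemma toENNReal_timeSeparation_add_le {x y z : M} (hxy : 0 ≤ S.timeSeparation x y)
    (hyz : 0 ≤ S.timeSeparation y z) :
    (S.timeSeparation x y).toENNReal + (S.timeSeparation y z).toENNReal ≤
      (S.timeSeparation x z).toENNReal := by
  -- The two suprema are resolved one after the other, so that one curve for each pair remains to be
  -- concatenated.
  refine add_toENNReal_timeSeparation_le hyz fun τ h4 h5 h6 => ?_
  rw [add_comm]
  refine add_toENNReal_timeSeparation_le hxy fun σ h1 h2 h3 => ?_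
  obtain ⟨ρ, hρ, e0, -, e2, hl⟩ := exists_concatenation h1 h4 (h3.trans h5.symm)
  rw [add_comm, ← hl, ← h2, ← h6, ← e0, ← e2]
  exact hρ.lengthOn_le_toENNReal two_pos

/-- In a causally simple spacetime the causal relation is antisymmetric. -/
lemma timeSeparation_antisymm (hS : S.CausallySimple) {x y : M}
    (hxy : 0 ≤ S.timeSeparation x y) (hyx : 0 ≤ S.timeSeparation y x) : x = y := by
  obtain ⟨σ, hσ, hσ0, hσ1⟩ := exists_causalCurve hxy
  obtain ⟨τ, hτ, hτ0, hτ1⟩ := exists_causalCurve hyx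
  obtain ⟨ρ, hρ, e0, e1, e2, -⟩ := exists_concatenation hσ hτ (hσ1.trans hτ0.symm)
  have h1 := (isCausalCurveOn_zero_one_iff.1 (hρ.comp_affine two_pos)).2
  -- The loop starts at `x` and passes through the junction `y` at time `1 / 2`.
  have h2 := hS.1 _ h1 (by simp [e0, e2, hσ0, hτ1]) (1 / 2) ⟨by norm_num, by norm_num⟩
  simp only [sub_zero, zero_mul, add_zero] at h2
  rw [show (0 : ℝ) + 1 / 2 * 2 = 1 by norm_num, e1, e0, hσ0, hσ1] at h2
  exact h2.symm

end ContinuousSpacetime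

end CausalCurves

/-! ### Local estimates of the time separation -/

lemma nonempty_inter_frontier_of_isPreconnected {X : Type*} [TopologicalSpace X] {s t : Set X}
    (hs : IsPreconnected s) {x y : X} (hx : x ∈ s) (hxt : x ∈ t) (hy : y ∈ s) (hyt : y ∉ t) :
    (s ∩ frontier t).Nonempty := by
  by_contra hcon
  have hn : ∀ z ∈ s, z ∉ frontier t := fun z hz hz' => hcon ⟨z, hz, hz'⟩
  have hcov : s ⊆ interior t ∪ (closure t)ᶜ := by
    intro z hz
    by_cases h : z ∈ interior t
    · exact Or.inl h
    · exact Or.inr fun h' => hn z hz ⟨h', h⟩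
  have h1 : x ∈ interior t := by
    by_contra h
    exact hn x hx ⟨subset_closure hxt, h⟩
  have h2 : y ∈ (closure t)ᶜ := fun h => hn y hy ⟨h, fun h' => hyt (interior_subset h')⟩
  obtain ⟨z, -, hz1, hz2⟩ := hs _ _ isOpen_interior isClosed_closure.isOpen_compl hcov
    ⟨x, hx, h1⟩ ⟨y, hy, h2⟩
  exact hz2 (interior_subset_closure hz1)

section LocalEstimates

variable {d : ℕ} {M : Type*} [TopologicalSpace M]
  [ChartedSpace (EuclideanSpace ℝ (Fin (d + 1))) M] [IsManifold (𝓡 (d + 1)) ∞ M]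

namespace ContinuousSpacetime

variable (S : ContinuousSpacetime d M)

/-- The time field in the coordinates of the chart at `x₀`. -/
noncomputable def coordField (x₀ p : M) : EuclideanSpace ℝ (Fin (d + 1)) :=
  coordVector x₀ p (S.timeField p)

lemma coordMetric_coordField_neg {x₀ p : M} (hp : p ∈ (extChartAt (𝓡 (d + 1)) x₀).source) :
    S.coordMetric x₀ p (S.coordField x₀ p) (S.coordField x₀ p) < 0 := by
  unfold coordField
  rw [S.coordMetric_apply hp]
  exact S.timelike_timeField p

lemma lorentzNorm_eq {x₀ p : M} (hp : p ∈ (extChartAt (𝓡 (d + 1)) x₀).source)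
    (v : TangentSpace (𝓡 (d + 1)) p) :
    S.lorentzNorm v = √(-(S.coordMetric x₀ p (coordVector x₀ p v) (coordVector x₀ p v))) := by
  rw [S.coordMetric_apply hp]; rfl

variable {S}

lemma InFuture.inFutureCone {x₀ p : M} (hp : p ∈ (extChartAt (𝓡 (d + 1)) x₀).source)
    {v : TangentSpace (𝓡 (d + 1)) p} (h : S.InFuture v) :
    InFutureCone (S.coordMetric x₀ p) (S.coordField x₀ p) (coordVector x₀ p v) := by
  rcases h with rfl | ⟨h1, h2⟩
  · exact Or.inl (map_zero _)
  · refine Or.inr ⟨?_, ?_⟩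
    · rw [S.coordMetric_apply hp]
      rcases h1 with h1 | h1
      exacts [h1.le, h1.1.le]
    · unfold coordField; rw [S.coordMetric_apply hp]; exact h2

lemma inFuture_of_coord {x₀ p : M} (hp : p ∈ (extChartAt (𝓡 (d + 1)) x₀).source)
    {v : TangentSpace (𝓡 (d + 1)) p}
    (h1 : S.coordMetric x₀ p (coordVector x₀ p v) (coordVector x₀ p v) < 0)
    (h2 : S.coordMetric x₀ p (coordVector x₀ p v) (S.coordField x₀ p) < 0) : S.InFuture v := by
  unfold coordField at h2
  rw [S.coordMetric_apply hp] at h1 h2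
  exact Or.inr ⟨Or.inl h1, h2⟩

/-- Integration of a linear bound for the Lorentz norm of the velocity. -/
lemma IsCausalCurveOn.mul_lengthOn_le {σ : ℝ → M} {x₀ : M} {U : Set M} {c : ℝ}
    (h : S.IsCausalCurveOn σ 0 1) (hσ : MapsTo σ (Icc 0 1) U)
    (hU : U ⊆ (extChartAt (𝓡 (d + 1)) x₀).source) (ψ : EuclideanSpace ℝ (Fin (d + 1)) →L[ℝ] ℝ)
    (hc : 0 ≤ c)
    (hψ : ∀ p ∈ U, ∀ w, InFutureCone (S.coordMetric x₀ p) (S.coordField x₀ p) w →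
      c * √(-(S.coordMetric x₀ p w w)) ≤ ψ w) :
    ENNReal.ofReal c * S.lengthOn σ 0 1 ≤
      ENNReal.ofReal (ψ (extChartAt (𝓡 (d + 1)) x₀ (σ 1) - extChartAt (𝓡 (d + 1)) x₀ (σ 0))) ∧
    0 ≤ ψ (extChartAt (𝓡 (d + 1)) x₀ (σ 1) - extChartAt (𝓡 (d + 1)) x₀ (σ 0)) := by
  set φ := extChartAt (𝓡 (d + 1)) x₀ with hφ
  obtain ⟨K, hK⟩ := h.lipschitz.exists_lipschitzOnWith_chart (x₀ := x₀) fun t ht => hU (hσ ht)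
  -- The fundamental theorem of calculus makes `ψ` of the displacement the integral of `ψ` of the
  -- velocity, which dominates `c` times the Lorentz norm.
  have hf : AbsolutelyContinuousOnInterval (fun t => ψ (φ (σ t))) 0 1 := by
    refine LipschitzOnWith.absolutelyContinuousOnInterval (K := ‖ψ‖₊ * K) ?_
    rw [uIcc_of_le zero_le_one]
    exact ψ.lipschitz.comp_lipschitzOnWith hK
  have hbound : ∀ᵐ t ∂(volume.restrict (Ioo (0 : ℝ) 1)),
      c * S.lorentzNorm (curveVelocity (d := d) σ t) ≤ deriv (fun t => ψ (φ (σ t))) t := by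
    have hd := hK.ae_differentiableWithinAt_of_mem_real
    filter_upwards [h.future, ae_restrict_of_ae hd, ae_restrict_mem measurableSet_Ioo]
      with t ht1 ht2 ht3
    have hnhds : Icc (0 : ℝ) 1 ∈ 𝓝 t := Icc_mem_nhds ht3.1 ht3.2
    have ht4 : DifferentiableAt ℝ (φ ∘ σ) t :=
      (ht2 (Ioo_subset_Icc_self ht3)).differentiableAt hnhds
    have hmem := hσ (Ioo_subset_Icc_self ht3)
    have hder : deriv (fun t => ψ (φ (σ t))) t = ψ (deriv (φ ∘ σ) t) :=
      (ψ.hasFDerivAt.comp_hasDerivAt t ht4.hasDerivAt).deriv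
    rw [hder, deriv_chart_comp (h.lipschitz.1.continuousAt hnhds) (hU hmem),
      S.lorentzNorm_eq (hU hmem)]
    exact hψ _ hmem _ (InFuture.inFutureCone (hU hmem) ht1)
  have hint : ∫ t in Ioo (0 : ℝ) 1, deriv (fun t => ψ (φ (σ t))) t = ψ (φ (σ 1) - φ (σ 0)) := by
    have := hf.integral_deriv_eq_sub
    rw [intervalIntegral.integral_of_le zero_le_one, ← restrict_Ioo_eq_restrict_Ioc] at this
    rw [this, map_sub]
  have hint' : IntegrableOn (deriv (fun t => ψ (φ (σ t)))) (Ioo 0 1) := by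
    have := hf.intervalIntegrable_deriv
    rw [intervalIntegrable_iff_integrableOn_Ioo_of_le zero_le_one] at this
    exact this
  have hnn : ∀ᵐ t ∂(volume.restrict (Ioo (0 : ℝ) 1)), 0 ≤ deriv (fun t => ψ (φ (σ t))) t := by
    filter_upwards [hbound] with t ht
    exact (mul_nonneg hc (Real.sqrt_nonneg _)).trans ht
  refine ⟨?_, by rw [← hint]; exact integral_nonneg_of_ae hnn⟩
  rw [← hint, ofReal_integral_eq_lintegral_ofReal hint' hnn]
  unfold lengthOn
  rw [← lintegral_const_mul' _ _ ENNReal.ofReal_ne_top]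
  refine lintegral_mono_ae ?_
  filter_upwards [hbound] with t ht
  rw [← ENNReal.ofReal_mul hc]
  exact ENNReal.ofReal_le_ofReal ht

/-- Strong causality: causal curves with endpoints close to `x₀` stay close to `x₀`. -/
lemma eventually_causalCurve_mapsTo [T2Space M] (hS : S.CausallySimple) {x₀ : M} {U : Set M}
    (hU : U ∈ 𝓝 x₀) : ∀ᶠ q in 𝓝 (x₀, x₀), ∀ σ : ℝ → M, S.IsCausalCurveOn σ 0 1 →
      σ 0 = q.1 → σ 1 = q.2 → MapsTo σ (Icc 0 1) U := by
  have : LocallyCompactSpace M := Manifold.locallyCompact_of_finiteDimensional (𝓡 (d + 1))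
  obtain ⟨K, hK, hKU, hKc⟩ := local_compact_nhds hU
  have hx₀ : x₀ ∈ interior K := mem_interior_iff_mem_nhds.2 hK
  have hfc : IsCompact (frontier K) :=
    hKc.of_isClosed_subset isClosed_frontier hKc.isClosed.frontier_subset
  -- A curve leaving `K` meets the compact frontier at some `z` with `q.1 ≤ z ≤ q.2`. At `q = (x₀,
  -- x₀)` antisymmetry gives `z = x₀`, which is interior to `K`; closedness of the relation and
  -- compactness exclude such `z` for all nearby `q`.
  have key : ∀ᶠ q : M × M in 𝓝 (x₀, x₀), ∀ z ∈ frontier K,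
      ¬ (0 ≤ S.timeSeparation q.1 z ∧ 0 ≤ S.timeSeparation z q.2) := by
    refine hfc.eventually_forall_of_forall_eventually (P := fun (q : M × M) (z : M) =>
      ¬ (0 ≤ S.timeSeparation q.1 z ∧ 0 ≤ S.timeSeparation z q.2)) fun z hz => ?_
    have hcl : IsClosed {r : (M × M) × M |
        0 ≤ S.timeSeparation r.1.1 r.2 ∧ 0 ≤ S.timeSeparation r.2 r.1.2} :=
      (hS.2.preimage (f := fun r : (M × M) × M => (r.1.1, r.2)) (by fun_prop)).inter
        (hS.2.preimage (f := fun r : (M × M) × M => (r.2, r.1.2)) (by fun_prop))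
    refine hcl.isOpen_compl.mem_nhds fun hmem => ?_
    have := timeSeparation_antisymm hS hmem.1 hmem.2
    simp only at this
    rw [← this] at hz
    exact hz.2 hx₀
  have hint : ∀ᶠ q : M × M in 𝓝 (x₀, x₀), q.1 ∈ interior K ∧ q.2 ∈ interior K :=
    (isOpen_interior.prod isOpen_interior).mem_nhds (mk_mem_prod hx₀ hx₀)
  filter_upwards [key, hint] with q hq hqK σ hσ hσ0 hσ1 t ht
  by_contra hcon
  have htK : σ t ∉ K := fun h => hcon (hKU h)
  have hconn : IsPreconnected (σ '' Icc 0 t) :=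
    isPreconnected_Icc.image _ (hσ.lipschitz.1.mono (Icc_subset_Icc le_rfl ht.2))
  obtain ⟨z, ⟨s, hs, rfl⟩, hz⟩ : (σ '' Icc 0 t ∩ frontier K).Nonempty := by
    refine nonempty_inter_frontier_of_isPreconnected hconn ⟨0, ⟨le_rfl, ht.1⟩, rfl⟩ ?_
      ⟨t, ⟨ht.1, le_rfl⟩, rfl⟩ htK
    rw [hσ0]; exact interior_subset hqK.1
  have hs0 : 0 < s := by
    refine lt_of_le_of_ne hs.1 ?_
    rintro rfl
    rw [hσ0] at hz; exact hz.2 hqK.1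
  have hs1 : s < 1 := by
    refine lt_of_le_of_ne (hs.2.trans ht.2) ?_
    rintro rfl
    rw [hσ1] at hz; exact hz.2 hqK.2
  refine hq _ hz ⟨?_, ?_⟩
  · rw [← hσ0]; exact (hσ.mono le_rfl hs1.le).timeSeparation_nonneg hs0
  · rw [← hσ1]; exact (hσ.mono hs0.le le_rfl).timeSeparation_nonneg hs1

variable (S)

lemma tendsto_coordMetric (x₀ : M) :
    Tendsto (S.coordMetric x₀) (𝓝 x₀) (𝓝 (S.coordMetric x₀ x₀)) := S.continuousAt_coordMetric x₀

lemma tendsto_coordField (x₀ : M) :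
    Tendsto (S.coordField x₀) (𝓝 x₀) (𝓝 (S.coordField x₀ x₀)) := S.continuousAt_coordField x₀

/-- The linear functional `w ↦ -g(w, X)` in the coordinates at `x₀`. -/
noncomputable def timeFunctional (x₀ : M) : EuclideanSpace ℝ (Fin (d + 1)) →L[ℝ] ℝ :=
  -((S.coordMetric x₀ x₀).flip (S.coordField x₀ x₀))

lemma exists_coercive_cone (x₀ : M) : ∃ k > 0, ∀ᶠ p in 𝓝 x₀, ∀ w,
    InFutureCone (S.coordMetric x₀ p) (S.coordField x₀ p) w → k * ‖w‖ ≤ S.timeFunctional x₀ w :=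
  eventually_inFutureCone_coercive (S.isLorentzianForm_coordMetric (mem_extChartAt_source x₀))
    (S.coordMetric_coordField_neg (mem_extChartAt_source x₀)) (S.tendsto_coordMetric x₀)
    (S.tendsto_coordField x₀)

variable {S}

/-- Locally, the displacement along a causal curve is controlled by the change of time. -/
lemma exists_norm_sub_le [T2Space M] (hS : S.CausallySimple) (x₀ : M) :
    ∃ k > 0, ∀ᶠ q in 𝓝 (x₀, x₀), 0 ≤ S.timeSeparation q.1 q.2 →
      k * ‖extChartAt (𝓡 (d + 1)) x₀ q.2 - extChartAt (𝓡 (d + 1)) x₀ q.1‖ ≤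
        S.timeFunctional x₀ (extChartAt (𝓡 (d + 1)) x₀ q.2 - extChartAt (𝓡 (d + 1)) x₀ q.1) := by
  obtain ⟨k, hk, hev⟩ := S.exists_coercive_cone x₀
  refine ⟨k, hk, ?_⟩
  filter_upwards [eventually_causalCurve_mapsTo hS (inter_mem hev (extChartAt_source_mem_nhds
    (I := 𝓡 (d + 1)) x₀))] with q hq hts
  obtain ⟨σ, hσ, h0, h1⟩ := exists_causalCurve hts
  -- With `ξ` norming the displacement, `timeFunctional - k ξ` is nonnegative on the nearby cones,
  -- hence on the displacement; the length estimate is used with `c = 0`.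
  obtain ⟨ξ, hξ1, hξ2⟩ := exists_dual_vector'' ℝ
    (extChartAt (𝓡 (d + 1)) x₀ q.2 - extChartAt (𝓡 (d + 1)) x₀ q.1)
  have := (hσ.mul_lengthOn_le (c := 0) (hq σ hσ h0 h1) inter_subset_right
    (S.timeFunctional x₀ - k • ξ) le_rfl (fun p hp w hw => ?_)).2
  · rw [h0, h1, sub_apply, smul_apply, hξ2, smul_eq_mul] at this
    simpa using this
  · have h2 := hp.1 w hw
    have h3 : ξ w ≤ ‖w‖ := by
      have := (le_abs_self _).trans (ξ.le_of_opNorm_le hξ1 w)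
      simpa using this
    rw [zero_mul, sub_apply, smul_apply, smul_eq_mul]
    nlinarith

/-- Locally, the time separation is bounded by linear functionals of the displacement. -/
lemma eventually_timeSeparation_le [T2Space M] (hS : S.CausallySimple) {x₀ : M}
    {u : EuclideanSpace ℝ (Fin (d + 1))} (hu : S.coordMetric x₀ x₀ u u < 0)
    (huX : S.coordMetric x₀ x₀ u (S.coordField x₀ x₀) < 0) {η : ℝ} (hη : 0 < η) :
    ∀ᶠ q in 𝓝 (x₀, x₀), 0 ≤ S.timeSeparation q.1 q.2 →
      ENNReal.ofReal √(-(S.coordMetric x₀ x₀ u u)) * (S.timeSeparation q.1 q.2).toENNReal ≤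
        ENNReal.ofReal ((-(S.coordMetric x₀ x₀ u) + η • S.timeFunctional x₀)
          (extChartAt (𝓡 (d + 1)) x₀ q.2 - extChartAt (𝓡 (d + 1)) x₀ q.1)) ∧
      0 ≤ (-(S.coordMetric x₀ x₀ u) + η • S.timeFunctional x₀)
          (extChartAt (𝓡 (d + 1)) x₀ q.2 - extChartAt (𝓡 (d + 1)) x₀ q.1) := by
  obtain ⟨k, hk, hev⟩ := S.exists_coercive_cone x₀
  have hsrc := extChartAt_source_mem_nhds (I := 𝓡 (d + 1)) x₀
  -- The error is taken as `η k ‖w‖`, which is at most `η` times the time functional and so linear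
  -- in `w`.
  have hev2 := eventually_sqrt_mul_sqrt_le (l := 𝓝 x₀)
    (mem_of_superset hsrc fun p hp => S.isLorentzianForm_coordMetric hp)
    (mem_of_superset hsrc fun p hp => S.coordMetric_coordField_neg hp)
    (S.tendsto_coordMetric x₀) (S.tendsto_coordField x₀) hu huX (mul_pos hη hk)
  have hpos : 0 < √(-(S.coordMetric x₀ x₀ u u)) := Real.sqrt_pos.2 (by linarith)
  filter_upwards [eventually_causalCurve_mapsTo hS (inter_mem (inter_mem hev hev2) hsrc)]
    with q hq hts
  have key : ∀ σ : ℝ → M, S.IsCausalCurveOn σ 0 1 → σ 0 = q.1 → σ 1 = q.2 → _ :=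
    fun σ hσ h0 h1 => hσ.mul_lengthOn_le (c := √(-(S.coordMetric x₀ x₀ u u))) (hq σ hσ h0 h1)
      inter_subset_right (-(S.coordMetric x₀ x₀ u) + η • S.timeFunctional x₀) hpos.le
      fun p hp w hw => by
        have h2 := hp.1.1 w hw
        have h3 := hp.1.2 w hw
        have h5 : (-(S.coordMetric x₀ x₀ u) + η • S.timeFunctional x₀) w =
          -(S.coordMetric x₀ x₀ u w) + η * S.timeFunctional x₀ w := rfl
        rw [h5]
        have h4 := mul_le_mul_of_nonneg_left h2 hη.le
        linarith
  constructor
  · rw [mul_comm, ← ENNReal.le_div_iff_mul_le (Or.inl (ENNReal.ofReal_pos.2 hpos).ne')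
      (Or.inl ENNReal.ofReal_ne_top)]
    refine toENNReal_timeSeparation_le fun σ hσ h0 h1 => ?_
    rw [ENNReal.le_div_iff_mul_le (Or.inl (ENNReal.ofReal_pos.2 hpos).ne')
      (Or.inl ENNReal.ofReal_ne_top), mul_comm, ← h0, ← h1]
    exact (key σ hσ h0 h1).1
  · obtain ⟨σ, hσ, h0, h1⟩ := exists_causalCurve hts
    rw [← h0, ← h1]
    exact (key σ hσ h0 h1).2

/-- Locally, timelike coordinate segments bound the time separation from below. -/
lemma eventually_le_timeSeparation {x₀ : M} {v : EuclideanSpace ℝ (Fin (d + 1))}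
    (hv : S.coordMetric x₀ x₀ v v < 0) (hvX : S.coordMetric x₀ x₀ v (S.coordField x₀ x₀) < 0)
    {c : ℝ} (hc : c < √(-(S.coordMetric x₀ x₀ v v))) :
    ∀ᶠ z in 𝓝 ((x₀, x₀), v), ∀ r > 0,
      extChartAt (𝓡 (d + 1)) x₀ z.1.2 - extChartAt (𝓡 (d + 1)) x₀ z.1.1 = r • z.2 →
      ENNReal.ofReal (c * r) ≤ (S.timeSeparation z.1.1 z.1.2).toENNReal := by
  set φ := extChartAt (𝓡 (d + 1)) x₀ with hφ
  have hev := eventually_timelike (S.tendsto_coordMetric x₀) (S.tendsto_coordField x₀) hv hvX hc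
  obtain ⟨U, hU, W, hW, hUW⟩ := eventually_prod_iff.1 hev
  have hsrc := extChartAt_source_mem_nhds (I := 𝓡 (d + 1)) x₀
  have htgt : φ.target ∈ 𝓝 (φ x₀) := extChartAt_target_mem_nhds x₀
  have hUφ : {y | U (φ.symm y)} ∈ 𝓝 (φ x₀) := by
    have h1 : Tendsto φ.symm (𝓝 (φ x₀)) (𝓝 (φ.symm (φ x₀))) := continuousAt_extChartAt_symm x₀
    rw [extChartAt_to_inv] at h1
    exact h1.eventually hU
  -- A coordinate ball is convex, so segments between its points stay where the metric estimates
  -- hold.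
  obtain ⟨ρ, hρ, hball⟩ := Metric.mem_nhds_iff.1 (inter_mem htgt hUφ)
  have hnear : ∀ᶠ p in 𝓝 x₀, p ∈ φ.source ∧ φ p ∈ Metric.ball (φ x₀) ρ :=
    inter_mem hsrc ((continuousAt_extChartAt x₀) (Metric.ball_mem_nhds _ hρ))
  have hnear2 : ∀ᶠ z in 𝓝 ((x₀, x₀), v), ((z.1.1 ∈ φ.source ∧ φ z.1.1 ∈ Metric.ball (φ x₀) ρ) ∧
      (z.1.2 ∈ φ.source ∧ φ z.1.2 ∈ Metric.ball (φ x₀) ρ)) ∧ W z.2 := by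
    have c1 : Tendsto (fun z : (M × M) × EuclideanSpace ℝ (Fin (d + 1)) => z.1.1)
      (𝓝 ((x₀, x₀), v)) (𝓝 x₀) := Continuous.tendsto (by fun_prop) _
    have c2 : Tendsto (fun z : (M × M) × EuclideanSpace ℝ (Fin (d + 1)) => z.1.2)
      (𝓝 ((x₀, x₀), v)) (𝓝 x₀) := Continuous.tendsto (by fun_prop) _
    have c3 : Tendsto (fun z : (M × M) × EuclideanSpace ℝ (Fin (d + 1)) => z.2)
      (𝓝 ((x₀, x₀), v)) (𝓝 v) := Continuous.tendsto (by fun_prop) _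
    exact ((c1.eventually hnear).and (c2.eventually hnear)).and (c3.eventually hW)
  filter_upwards [hnear2] with z hz r hr hzr
  obtain ⟨⟨p, p'⟩, w⟩ := z
  obtain ⟨⟨⟨hp, hpb⟩, ⟨hp', hpb'⟩⟩, hw⟩ := hz
  simp only at hp hpb hp' hpb' hw hzr ⊢
  -- The coordinate segment from `p` to `p'` has constant velocity `r • w`, future timelike because
  -- `w` is close to `v`.
  set L : ℝ → EuclideanSpace ℝ (Fin (d + 1)) := fun t => φ p + t • (r • w) with hL
  have hLc : Continuous L := by fun_prop
  have hLb : ∀ t ∈ Icc (0 : ℝ) 1, L t ∈ Metric.ball (φ x₀) ρ := by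
    intro t ht
    have : L t = (1 - t) • φ p + t • φ p' := by
      rw [hL]; simp only; rw [← hzr]; module
    rw [this]
    exact (convex_ball (φ x₀) ρ) hpb hpb' (by linarith [ht.2]) ht.1 (by ring)
  have hLt : ∀ t ∈ Icc (0 : ℝ) 1, L t ∈ φ.target := fun t ht => (hball (hLb t ht)).1
  set σ : ℝ → M := fun t => φ.symm (L t) with hσ
  have hσs : MapsTo σ (Icc 0 1) φ.source := fun t ht => φ.map_target (hLt t ht)
  have hφσ : EqOn (φ ∘ σ) L (Icc 0 1) := fun t ht => φ.right_inv (hLt t ht)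
  have hσc : ContinuousOn σ (Icc 0 1) :=
    (continuousOn_extChartAt_symm x₀).comp hLc.continuousOn hLt
  have hLd : ∀ t, HasDerivAt L (r • w) t := by
    intro t
    have := ((hasDerivAt_id t).smul_const (r • w)).const_add (φ p)
    rw [one_smul] at this
    exact this
  have hvel : ∀ t ∈ Ioo (0 : ℝ) 1, coordVector x₀ (σ t) (curveVelocity (d := d) σ t) = r • w := by
    intro t ht
    have hnh : Icc (0 : ℝ) 1 ∈ 𝓝 t := Icc_mem_nhds ht.1 ht.2
    have h1 := deriv_chart_comp (d := d) (hσc.continuousAt hnh) (hσs (Ioo_subset_Icc_self ht))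
    refine h1.symm.trans ?_
    rw [(hφσ.eventuallyEq_of_mem hnh).deriv_eq]
    exact (hLd t).deriv
  have hlip : IsLipschitzCurveOn d σ (Icc 0 1) := by
    refine isLipschitzCurveOn_of_chart (x₀ := x₀) (K := ‖r • w‖₊) hσc hσs ?_
    refine LipschitzOnWith.of_eqOn (f := L) ?_ hφσ
    refine (LipschitzWith.of_dist_le_mul fun s t => ?_).lipschitzOnWith
    rw [hL, dist_add_left, dist_eq_norm, ← sub_smul, norm_smul, mul_comm, coe_nnnorm,
      Real.dist_eq, Real.norm_eq_abs]
  have hgood : ∀ t ∈ Ioo (0 : ℝ) 1, S.InFuture (curveVelocity (d := d) σ t) ∧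
      c * r ≤ S.lorentzNorm (curveVelocity (d := d) σ t) := by
    intro t ht
    have ht' := Ioo_subset_Icc_self ht
    obtain ⟨h1, h2, h3⟩ := hUW (hball (hLb t ht')).2 hw
    have h1' : S.coordMetric x₀ (σ t) w w < 0 := h1
    have h2' : S.coordMetric x₀ (σ t) w (S.coordField x₀ (σ t)) < 0 := h2
    have h3' : c < √(-(S.coordMetric x₀ (σ t) w w)) := h3
    constructor
    · refine inFuture_of_coord (hσs ht') ?_ ?_ <;> rw [hvel t ht] <;>
        simp only [map_smul, smul_apply, smul_eq_mul]
      · exact mul_neg_of_pos_of_neg hr (mul_neg_of_pos_of_neg hr h1')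
      · exact mul_neg_of_pos_of_neg hr h2'
    · rw [S.lorentzNorm_eq (hσs ht'), hvel t ht]
      simp only [map_smul, smul_apply, smul_eq_mul]
      rw [show -(r * (r * S.coordMetric x₀ (σ t) w w)) =
        r ^ 2 * -(S.coordMetric x₀ (σ t) w w) by ring, Real.sqrt_mul (sq_nonneg r),
        Real.sqrt_sq hr.le, mul_comm c]
      exact mul_le_mul_of_nonneg_left h3'.le hr.le
  have hcausal : S.IsCausalCurveOn σ 0 1 := by
    refine ⟨hlip, ?_⟩
    filter_upwards [ae_restrict_mem measurableSet_Ioo] with t ht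
    exact (hgood t ht).1
  have e0 : σ 0 = p := by simp only [hσ, hL, zero_smul, add_zero]; exact φ.left_inv hp
  have e1 : σ 1 = p' := by
    simp only [hσ, hL, one_smul]; rw [← hzr, add_sub_cancel]; exact φ.left_inv hp'
  have := hcausal.lengthOn_le_toENNReal one_pos
  rw [e0, e1] at this
  refine le_trans ?_ this
  calc ENNReal.ofReal (c * r) = ∫⁻ _ in Ioo (0 : ℝ) 1, ENNReal.ofReal (c * r) := by simp
    _ ≤ _ := setLIntegral_mono_ae' measurableSet_Ioo (Eventually.of_forall fun t ht =>
        ENNReal.ofReal_le_ofReal (hgood t ht).2)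

end ContinuousSpacetime

end LocalEstimates

/-! ### Derivatives along shrinking intervals -/

lemma straddleFilter_neBot (t : ℝ) : (straddleFilter t).NeBot := by
  have h : Tendsto (fun n : ℕ => (t, t + 1 / ((n : ℝ) + 1))) atTop (straddleFilter t) := by
    refine tendsto_straddleFilter (δ := fun n : ℕ => 1 / ((n : ℝ) + 1))
      tendsto_one_div_add_atTop_nhds_zero_nat (Eventually.of_forall fun n => ?_)
    have : 0 < 1 / ((n : ℝ) + 1) := by positivity
    exact ⟨by linarith, le_rfl, by linarith, by linarith⟩
  exact h.neBot

lemma eventually_straddleFilter (t : ℝ) :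
    ∀ᶠ p in straddleFilter t, p.1 < p.2 ∧ p.1 ≤ t ∧ t ≤ p.2 :=
  mem_inf_of_right (mem_principal_self _)

/-- As `t` lies between the endpoints, their distances to `t` add up to the length of the interval,
so the first order errors at both ends are small relative to it. -/
lemma HasDerivAt.tendsto_straddle {E : Type*} [NormedAddCommGroup E] [NormedSpace ℝ E]
    {y : ℝ → E} {w : E} {t : ℝ} (h : HasDerivAt y w t) :
    Tendsto (fun p : ℝ × ℝ => (p.2 - p.1)⁻¹ • (y p.2 - y p.1)) (straddleFilter t) (𝓝 w) := by
  rw [Metric.tendsto_nhds]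
  intro ε hε
  have h1 : ∀ᶠ s in 𝓝 t, ‖y s - y t - (s - t) • w‖ ≤ ε / 2 * ‖s - t‖ :=
    h.isLittleO.def (half_pos hε)
  have h2 : ∀ᶠ p : ℝ × ℝ in 𝓝 (t, t), ‖y p.1 - y t - (p.1 - t) • w‖ ≤ ε / 2 * ‖p.1 - t‖ ∧
      ‖y p.2 - y t - (p.2 - t) • w‖ ≤ ε / 2 * ‖p.2 - t‖ :=
    ((continuous_fst.tendsto (t, t)).eventually h1).and
      ((continuous_snd.tendsto (t, t)).eventually h1)
  filter_upwards [mem_inf_of_left h2, eventually_straddleFilter t] with p hp hp'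
  have hr : 0 < p.2 - p.1 := sub_pos.2 hp'.1
  have e : (p.2 - p.1)⁻¹ • (y p.2 - y p.1) - w = (p.2 - p.1)⁻¹ •
      ((y p.2 - y t - (p.2 - t) • w) - (y p.1 - y t - (p.1 - t) • w)) := by
    have : w = (p.2 - p.1)⁻¹ • ((p.2 - p.1) • w) := by rw [smul_smul, inv_mul_cancel₀ hr.ne', one_smul]
    conv_lhs => rw [this]
    module
  rw [dist_eq_norm, e, norm_smul, norm_inv, Real.norm_of_nonneg hr.le, inv_mul_lt_iff₀ hr]
  refine (norm_sub_le _ _).trans_lt ?_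
  have h3 := hp.1
  have h4 := hp.2
  rw [Real.norm_of_nonpos (by linarith [hp'.2.1])] at h3
  rw [Real.norm_of_nonneg (by linarith [hp'.2.2])] at h4
  nlinarith

/-! ### Left-continuous causal paths: differentiability and speed -/

section CausalPaths

variable {d : ℕ} {M : Type*} [TopologicalSpace M]
  [ChartedSpace (EuclideanSpace ℝ (Fin (d + 1))) M] [IsManifold (𝓡 (d + 1)) ∞ M]

namespace ContinuousSpacetime

variable {S : ContinuousSpacetime d M} {γ : ℝ → M}

/-- The linear upper bound with `u` the time field already bounds a positive multiple of the time
separation by a finite number. -/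
lemma eventually_toENNReal_lt_top [T2Space M] (hS : S.CausallySimple) (x₀ : M) :
    ∀ᶠ q in 𝓝 (x₀, x₀), 0 ≤ S.timeSeparation q.1 q.2 →
      (S.timeSeparation q.1 q.2).toENNReal < ⊤ := by
  have hX := S.coordMetric_coordField_neg (mem_extChartAt_source (I := 𝓡 (d + 1)) x₀)
  filter_upwards [eventually_timeSeparation_le hS hX hX one_pos] with q hq hts
  have h1 := (hq hts).1
  have hpos : 0 < √(-(S.coordMetric x₀ x₀ (S.coordField x₀ x₀) (S.coordField x₀ x₀))) :=
    Real.sqrt_pos.2 (by linarith)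
  by_contra htop
  rw [not_lt_top_iff.1 htop, ENNReal.mul_top (ENNReal.ofReal_pos.2 hpos).ne'] at h1
  exact absurd (h1.trans_lt ENNReal.ofReal_lt_top) (lt_irrefl _)

/-- A left-continuous path stays in a given neighbourhood on a left neighbourhood. -/
lemma exists_left_interval {ℓ : M → M → EReal} (hγ : IsLeftContinuousCausalPath ℓ γ) {t : ℝ}
    (ht : t ∈ Ioc (0 : ℝ) 1) {V : Set (M × M)} (hV : V ∈ 𝓝 (γ t, γ t)) :
    ∃ a < t, 0 ≤ a ∧ ∀ s ∈ Icc a t, ∀ s' ∈ Icc a t, (γ s, γ s') ∈ V := by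
  rw [nhds_prod_eq] at hV
  obtain ⟨U, hU, hUV⟩ := mem_prod_same_iff.1 hV
  have h1 : γ ⁻¹' U ∈ 𝓝[<] t := hγ.left_continuous t ht hU
  obtain ⟨b, hb, hbU⟩ := mem_nhdsLT_iff_exists_Ioo_subset.1 h1
  have hb' : b < t := hb
  have hmid : max b 0 < t := max_lt hb' ht.1
  have key : ∀ s ∈ Icc ((max b 0 + t) / 2) t, γ s ∈ U := by
    intro s hs
    rcases hs.2.eq_or_lt with rfl | hlt
    · exact mem_of_mem_nhds hU
    · refine hbU ⟨?_, hlt⟩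
      have := hs.1; have := le_max_left b 0; linarith
  refine ⟨(max b 0 + t) / 2, by linarith, ?_, fun s hs s' hs' => hUV ⟨key s hs, key s' hs'⟩⟩
  have := le_max_right b 0; linarith

/-- A curve whose displacements are controlled by a real-valued function is differentiable almost
everywhere. -/
lemma ae_differentiableAt_of_norm_sub_le {E : Type*} [NormedAddCommGroup E] [NormedSpace ℝ E]
    [FiniteDimensional ℝ E] {y : ℝ → E} {T : ℝ → ℝ} {a b k : ℝ} (hk : 0 < k)
    (h : ∀ s ∈ Icc a b, ∀ s' ∈ Icc a b, s ≤ s' → k * ‖y s' - y s‖ ≤ T s' - T s) :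
    ∀ᵐ x, x ∈ Ioo a b → DifferentiableAt ℝ y x := by
  have hT : MonotoneOn T (Icc a b) := by
    intro s hs s' hs' hss
    have h1 := h s hs s' hs' hss
    have h2 : 0 ≤ k * ‖y s' - y s‖ := by positivity
    linarith
  have habs : ∀ s ∈ Icc a b, ∀ s' ∈ Icc a b, k * ‖y s' - y s‖ ≤ |T s' - T s| := by
    intro s hs s' hs'
    rcases le_total s s' with hss | hss
    · exact (h s hs s' hs' hss).trans (le_abs_self _)
    · rw [norm_sub_rev, abs_sub_comm]
      exact (h s' hs' s hs hss).trans (le_abs_self _)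
  -- `y` is constant where `T` is, so `y = (y ∘ g) ∘ T` with `y ∘ g` Lipschitz on the image of the
  -- monotone `T`. Hence `y` has bounded variation, even though `T` may jump.
  set g : ℝ → ℝ := Function.invFunOn T (Icc a b) with hg
  have hgm : ∀ s ∈ Icc a b, g (T s) ∈ Icc a b := fun s hs => Function.invFunOn_mem ⟨s, hs, rfl⟩
  have hgT : ∀ s ∈ Icc a b, T (g (T s)) = T s := fun s hs => Function.invFunOn_eq ⟨s, hs, rfl⟩
  have hy : ∀ s ∈ Icc a b, y s = y (g (T s)) := by
    intro s hs
    have h1 := habs (g (T s)) (hgm s hs) s hs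
    rw [hgT s hs, sub_self, abs_zero] at h1
    have h2 : ‖y s - y (g (T s))‖ ≤ 0 := by
      by_contra! hcon
      have := mul_pos hk hcon
      linarith
    exact sub_eq_zero.1 (norm_le_zero_iff.1 h2)
  have hlip : LipschitzOnWith (Real.toNNReal k⁻¹) (y ∘ g) (T '' Icc a b) := by
    refine LipschitzOnWith.of_dist_le_mul ?_
    rintro _ ⟨s, hs, rfl⟩ _ ⟨s', hs', rfl⟩
    have h1 := habs s' hs' s hs
    simp only [Function.comp]
    rw [← hy s hs, ← hy s' hs', dist_eq_norm, Real.dist_eq, Real.coe_toNNReal _ (by positivity),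
      le_inv_mul_iff₀ hk]
    exact h1
  have hbv : LocallyBoundedVariationOn ((y ∘ g) ∘ T) (Icc a b) :=
    hlip.comp_locallyBoundedVariationOn (mapsTo_image T _) hT.locallyBoundedVariationOn
  filter_upwards [hbv.ae_differentiableWithinAt_of_mem] with x hx hxab
  have hnh : Icc a b ∈ 𝓝 x := Icc_mem_nhds hxab.1 hxab.2
  have h1 := (hx (Ioo_subset_Icc_self hxab)).differentiableAt hnh
  refine h1.congr_of_eventuallyEq ?_
  filter_upwards [hnh] with s hs
  exact hy s hs

/-- A left-continuous causal path is differentiable almost everywhere. -/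
lemma ae_mdifferentiableAt [T2Space M] (hS : S.CausallySimple)
    (hγ : IsLeftContinuousCausalPath S.timeSeparation γ) :
    ∀ᵐ t ∂(volume.restrict (Icc (0 : ℝ) 1)),
      MDifferentiableAt 𝓘(ℝ, ℝ) (𝓡 (d + 1)) γ t := by
  refine ae_restrict_Icc_of_forall_left fun t ht => ?_
  set φ := extChartAt (𝓡 (d + 1)) (γ t) with hφ
  obtain ⟨k, hk, hev⟩ := exists_norm_sub_le hS (γ t)
  have hsrc : ∀ᶠ q : M × M in 𝓝 (γ t, γ t), q.1 ∈ φ.source :=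
    (continuous_fst.tendsto (γ t, γ t)).eventually (extChartAt_source_mem_nhds (I := 𝓡 (d + 1)) _)
  obtain ⟨a, hat, ha0, ha⟩ := exists_left_interval hγ ht (hev.and hsrc)
  refine ⟨a, hat, ?_⟩
  have hd : ∀ᵐ x, x ∈ Ioo a t → DifferentiableAt ℝ (φ ∘ γ) x := by
    refine ae_differentiableAt_of_norm_sub_le (T := fun s => S.timeFunctional (γ t) (φ (γ s))) hk
      fun s hs s' hs' hss => ?_
    rw [← map_sub]
    exact (ha s hs s' hs').1 (hγ.causal s s' (ha0.trans hs.1) hss (hs'.2.trans ht.2))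
  filter_upwards [hd] with x hx hxat
  have hnh : Icc a t ∈ 𝓝 x := Icc_mem_nhds hxat.1 hxat.2
  have hxs : γ x ∈ φ.source := (ha x (Ioo_subset_Icc_self hxat) x (Ioo_subset_Icc_self hxat)).2
  -- Continuity of `γ` is not given to the right; it follows from that of the chart expression.
  have hcont : ContinuousAt γ x := by
    have h1 : ContinuousAt (φ.symm ∘ (φ ∘ γ)) x :=
      ContinuousAt.comp (continuousAt_extChartAt_symm' hxs) (hx hxat).continuousAt
    refine h1.congr ?_
    filter_upwards [hnh] with s hs
    exact φ.left_inv (ha s hs s hs).2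
  exact mdifferentiableAt_of_chart hcont hxs (hx hxat)

/-- At a time of differentiability, the velocity is causal and its length is the derivative of the
time separation along the path. -/
lemma tendsto_timeSeparation_div [T2Space M] (hS : S.CausallySimple)
    (hγ : IsLeftContinuousCausalPath S.timeSeparation γ) {t : ℝ} (ht : t ∈ Ioo (0 : ℝ) 1)
    (hd : MDifferentiableAt 𝓘(ℝ, ℝ) (𝓡 (d + 1)) γ t) :
    S.g (γ t) (curveVelocity (d := d) γ t) (curveVelocity (d := d) γ t) ≤ 0 ∧
    Tendsto (fun p : ℝ × ℝ => (S.timeSeparation (γ p.1) (γ p.2)).toENNReal /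
      ENNReal.ofReal (p.2 - p.1)) (straddleFilter t)
      (𝓝 (ENNReal.ofReal (S.lorentzNorm (curveVelocity (d := d) γ t)))) := by
  have := straddleFilter_neBot t
  obtain ⟨x₀, hx₀⟩ : ∃ x₀, x₀ = γ t := ⟨_, rfl⟩
  have hmem : γ t ∈ (extChartAt (𝓡 (d + 1)) x₀).source := by rw [hx₀]; exact mem_extChartAt_source _
  have hmem' : x₀ ∈ (extChartAt (𝓡 (d + 1)) x₀).source := mem_extChartAt_source _
  set φ := extChartAt (𝓡 (d + 1)) x₀ with hφ
  set w := coordVector x₀ (γ t) (curveVelocity (d := d) γ t) with hw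
  rw [S.lorentzNorm_eq hmem, ← S.coordMetric_apply hmem, ← hw, ← hx₀]
  set B := S.coordMetric x₀ x₀ with hB
  set X₀ := S.coordField x₀ x₀ with hX₀
  have hBL : IsLorentzianForm B := S.isLorentzianForm_coordMetric hmem'
  have hX : B X₀ X₀ < 0 := S.coordMetric_coordField_neg hmem'
  have hcont : ContinuousAt γ t := hd.continuousAt
  have hderiv : HasDerivAt (φ ∘ γ) w t := by
    have h1 : DifferentiableAt ℝ (φ ∘ γ) t := by
      have h2 := mdifferentiableAt_extChartAt (I := 𝓡 (d + 1)) (x := x₀) (y := γ t)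
        (by rwa [hφ, extChartAt_source] at hmem)
      exact (MDifferentiableAt.comp t h2 hd).differentiableAt
    have h3 : deriv (φ ∘ γ) t = w := deriv_chart_comp hcont hmem
    rw [← h3]; exact h1.hasDerivAt
  have hquot := hderiv.tendsto_straddle
  have hpair : Tendsto (fun p : ℝ × ℝ => (γ p.1, γ p.2)) (straddleFilter t) (𝓝 (x₀, x₀)) := by
    have h1 : Tendsto γ (𝓝 t) (𝓝 x₀) := by rw [hx₀]; exact hcont
    have h2 : Tendsto (fun p : ℝ × ℝ => (γ p.1, γ p.2)) (𝓝 (t, t)) (𝓝 (x₀, x₀)) :=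
      (h1.comp (continuous_fst.tendsto (t, t))).prodMk_nhds
        (h1.comp (continuous_snd.tendsto (t, t)))
    exact h2.mono_left inf_le_left
  have hcausal : ∀ᶠ p in straddleFilter t, 0 ≤ S.timeSeparation (γ p.1) (γ p.2) := by
    have h1 : ∀ᶠ p : ℝ × ℝ in 𝓝 (t, t), 0 ≤ p.1 ∧ p.2 ≤ 1 :=
      ((continuous_fst.tendsto (t, t)).eventually (lt_mem_nhds ht.1)).and
        ((continuous_snd.tendsto (t, t)).eventually (gt_mem_nhds ht.2)) |>.mono
        fun p hp => ⟨hp.1.le, hp.2.le⟩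
    filter_upwards [mem_inf_of_left h1, eventually_straddleFilter t] with p hp hp'
    exact hγ.causal _ _ hp.1 hp'.1.le hp.2
  set Q : ℝ × ℝ → ℝ≥0∞ := fun p => (S.timeSeparation (γ p.1) (γ p.2)).toENNReal /
      ENNReal.ofReal (p.2 - p.1) with hQ
  -- Divide the linear upper bound by the length of the interval and pass to the limit: the
  -- displacement quotient tends to `w`.
  have hupper : ∀ u, B u u < 0 → B u X₀ < 0 → ∀ η : ℝ, 0 < η →
      limsup Q (straddleFilter t) ≤
        ENNReal.ofReal ((-(B u) + η • S.timeFunctional x₀) w) / ENNReal.ofReal √(-(B u u)) ∧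
      0 ≤ (-(B u) + η • S.timeFunctional x₀) w := by
    intro u hu huX η hη
    set ψ := -(B u) + η • S.timeFunctional x₀ with hψ
    have hev := hpair.eventually (eventually_timeSeparation_le hS hu huX hη)
    have hψq := (ψ.continuous.tendsto w).comp hquot
    have hpos : 0 < √(-(B u u)) := Real.sqrt_pos.2 (by linarith)
    constructor
    · have hlim : Tendsto (fun p : ℝ × ℝ => ENNReal.ofReal
          (ψ ((p.2 - p.1)⁻¹ • ((φ ∘ γ) p.2 - (φ ∘ γ) p.1))) / ENNReal.ofReal √(-(B u u)))
          (straddleFilter t) (𝓝 (ENNReal.ofReal (ψ w) / ENNReal.ofReal √(-(B u u)))) :=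
        ENNReal.Tendsto.div_const ((ENNReal.continuous_ofReal.tendsto _).comp hψq)
          (Or.inr (ENNReal.ofReal_pos.2 hpos).ne')
      rw [← hlim.limsup_eq]
      refine limsup_le_limsup ?_
      filter_upwards [hev, hcausal, eventually_straddleFilter t] with p hp hpc hp'
      have hr : 0 < p.2 - p.1 := sub_pos.2 hp'.1
      have h1 := (hp hpc).1
      rw [ENNReal.le_div_iff_mul_le (Or.inl (ENNReal.ofReal_pos.2 hpos).ne')
        (Or.inl ENNReal.ofReal_ne_top), map_smul, smul_eq_mul, ← div_eq_inv_mul,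
        ENNReal.ofReal_div_of_pos hr, hQ]
      simp only [div_eq_mul_inv]
      rw [mul_right_comm]
      gcongr
      rw [mul_comm]
      exact h1
    · refine ge_of_tendsto hψq ?_
      filter_upwards [hev, hcausal, eventually_straddleFilter t] with p hp hpc hp'
      have hr : 0 < p.2 - p.1 := sub_pos.2 hp'.1
      have h1 := (hp hpc).2
      simp only [Function.comp]
      rw [map_smul, smul_eq_mul]
      exact mul_nonneg (inv_nonneg.2 hr.le) h1
  have hDfin : limsup Q (straddleFilter t) ≠ ⊤ := by
    refine ne_top_of_le_ne_top ?_ (hupper X₀ hX hX 1 one_pos).1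
    exact ENNReal.div_ne_top ENNReal.ofReal_ne_top
      (ENNReal.ofReal_pos.2 (Real.sqrt_pos.2 (by linarith))).ne'
  obtain ⟨D, hD⟩ : ∃ D, D = (limsup Q (straddleFilter t)).toReal := ⟨_, rfl⟩
  have hD0 : 0 ≤ D := by rw [hD]; exact ENNReal.toReal_nonneg
  have hDQ : limsup Q (straddleFilter t) = ENNReal.ofReal D := by
    rw [hD, ENNReal.ofReal_toReal hDfin]
  have hdual : ∀ u, B u u < 0 → B u X₀ < 0 → D * √(-(B u u)) ≤ -(B u w) := by
    intro u hu huX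
    have hpos : 0 < √(-(B u u)) := Real.sqrt_pos.2 (by linarith)
    refine le_of_forall_pos_le_add fun ε hε => ?_
    -- This `η` makes the error term at `w` at most `ε`.
    have hη : 0 < ε / (|S.timeFunctional x₀ w| + 1) := by positivity
    obtain ⟨h1, h2⟩ := hupper u hu huX _ hη
    rw [hDQ, ← ENNReal.ofReal_div_of_pos hpos, ENNReal.ofReal_le_ofReal_iff (by positivity),
      le_div_iff₀ hpos] at h1
    refine h1.trans ?_
    have h3 : (-(B u) + (ε / (|S.timeFunctional x₀ w| + 1)) • S.timeFunctional x₀) w =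
      -(B u w) + ε / (|S.timeFunctional x₀ w| + 1) * S.timeFunctional x₀ w := rfl
    rw [h3]
    have h4 : ε / (|S.timeFunctional x₀ w| + 1) * S.timeFunctional x₀ w ≤
        ε / (|S.timeFunctional x₀ w| + 1) * (|S.timeFunctional x₀ w| + 1) := by
      gcongr
      exact (le_abs_self _).trans (by linarith)
    rw [div_mul_cancel₀ _ (by positivity)] at h4
    linarith
  obtain ⟨hww, hDle⟩ := hBL.le_sqrt_of_forall_timelike hX hD0 hdual
  refine ⟨hww, tendsto_of_le_liminf_of_limsup_le ?_ ?_⟩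
  -- When `B w w = 0` the claimed limit is zero and the lower bound is trivial.
  · rcases hww.eq_or_lt with h0 | hneg
    · rw [h0]; simp
    have hwX : B w X₀ < 0 := by
      have h1 := hdual X₀ hX hX
      have h2 : 0 ≤ D * √(-(B X₀ X₀)) := by positivity
      -- `hdual` at `X₀` gives the weak inequality; equality would put `w` in the orthogonal
      -- complement of `X₀`, where no vector is timelike.
      refine lt_of_le_of_ne (by rw [hBL.symm]; linarith) fun h3 => ?_
      rw [hBL.symm] at h3
      have := hBL.nonneg hX h3
      linarith
    refine le_of_forall_lt fun b hb => ?_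
    have hbt : b ≠ ⊤ := (hb.trans ENNReal.ofReal_lt_top).ne
    obtain ⟨b', hbb', hb'⟩ := exists_between hb
    have hb't : b' ≠ ⊤ := (hb'.trans ENNReal.ofReal_lt_top).ne
    refine hbb'.trans_le ?_
    have hc : b'.toReal < √(-(B w w)) := (ENNReal.lt_ofReal_iff_toReal_lt hb't).1 hb'
    have hev := eventually_le_timeSeparation hneg hwX hc
    have hz : Tendsto (fun p : ℝ × ℝ => ((γ p.1, γ p.2),
        (p.2 - p.1)⁻¹ • ((φ ∘ γ) p.2 - (φ ∘ γ) p.1))) (straddleFilter t) (𝓝 ((x₀, x₀), w)) :=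
      hpair.prodMk_nhds hquot
    refine le_liminf_of_le (by isBoundedDefault) ?_
    filter_upwards [hz.eventually hev, eventually_straddleFilter t] with p hp hp'
    have hr : 0 < p.2 - p.1 := sub_pos.2 hp'.1
    have h1 := hp (p.2 - p.1) hr (by
      simp only [Function.comp]
      rw [smul_smul, mul_inv_cancel₀ hr.ne', one_smul])
    rw [hQ]
    simp only
    rw [ENNReal.le_div_iff_mul_le (Or.inl (ENNReal.ofReal_pos.2 hr).ne')
      (Or.inl ENNReal.ofReal_ne_top)]
    refine le_trans (le_of_eq ?_) h1
    rw [ENNReal.ofReal_mul ENNReal.toReal_nonneg, ENNReal.ofReal_toReal hb't]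
  · rw [hDQ]
    exact ENNReal.ofReal_le_ofReal hDle

lemma intervalSuperadditive_timeSeparation
    (hγ : IsLeftContinuousCausalPath S.timeSeparation γ) :
    IntervalSuperadditive fun s t => (S.timeSeparation (γ s) (γ t)).toENNReal := by
  intro r s t h0 hrs hst h1
  exact toENNReal_timeSeparation_add_le (hγ.causal r s h0 hrs (hst.trans h1))
    (hγ.causal s t (h0.trans hrs) hst h1)

end ContinuousSpacetime

/-- Along a causal path `ℓ` is nonnegative, so its truncation to `ℝ≥0∞` loses nothing. -/
lemma speedMinorants_eq {X : Type*} [TopologicalSpace X] {ℓ : X → X → EReal} {γ : ℝ → X}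
    (hγ : IsLeftContinuousCausalPath ℓ γ) :
    speedMinorants ℓ γ = intervalMinorants fun s t => (ℓ (γ s) (γ t)).toENNReal := by
  ext μ
  refine and_congr_right fun _ => ?_
  refine forall₂_congr fun s t => ?_
  refine forall₃_congr fun h0 hst h1 => ?_
  rw [← EReal.coe_ennreal_le_coe_ennreal_iff, EReal.coe_toENNReal (hγ.causal s t h0 hst h1)]

lemma causalSpeedMeasure_eq {X : Type*} [TopologicalSpace X] {ℓ : X → X → EReal} {γ : ℝ → X}
    (hγ : IsLeftContinuousCausalPath ℓ γ)
    (hℓ : IntervalSuperadditive fun s t => (ℓ (γ s) (γ t)).toENNReal) :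
    causalSpeedMeasure ℓ γ = greatestMinorant fun s t => (ℓ (γ s) (γ t)).toENNReal := by
  unfold causalSpeedMeasure
  rw [speedMinorants_eq hγ]
  exact (greatestMinorant_isGreatest hℓ).isLUB.sSup_eq

end CausalPaths

theorem mainTheorem3 {d : ℕ} (hd : 1 ≤ d) {M : Type*} [TopologicalSpace M] [T2Space M]
    [SecondCountableTopology M] [ChartedSpace (EuclideanSpace ℝ (Fin (d + 1))) M]
    [IsManifold (𝓡 (d + 1)) ∞ M] (S : ContinuousSpacetime d M) (hS : S.CausallySimple)
    (γ : ℝ → M) (hγ : IsLeftContinuousCausalPath S.timeSeparation γ) :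
    -- the causal speed is well defined: the maximal measure exists and can be decomposed
    IsGreatest (speedMinorants S.timeSeparation γ) (causalSpeedMeasure S.timeSeparation γ) ∧
    (causalSpeedMeasure S.timeSeparation γ).HaveLebesgueDecomposition volume ∧
    -- for almost every time the derivative exists, is zero or causal, and its length is the speed
    ∀ᵐ t ∂(volume.restrict (Icc (0 : ℝ) 1)),
      MDifferentiableWithinAt 𝓘(ℝ, ℝ) (𝓡 (d + 1)) γ (Icc (0 : ℝ) 1) t ∧
      S.g (γ t) (velocity (d := d) γ t) (velocity (d := d) γ t) ≤ 0 ∧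
      causalSpeed S.timeSeparation γ t =
        ENNReal.ofReal (S.lorentzNorm (velocity (d := d) γ t)) := by
  have hL := ContinuousSpacetime.intervalSuperadditive_timeSeparation hγ
  have hmeas := causalSpeedMeasure_eq hγ hL
  -- Left neighbourhoods do not control the mass at `0`; finiteness near `(γ 0, γ 0)` holds in
  -- particular at that pair.
  have h0 : (S.timeSeparation (γ 0) (γ 0)).toENNReal < ⊤ :=
    (ContinuousSpacetime.eventually_toENNReal_lt_top hS (γ 0)).self_of_nhds
      (hγ.causal 0 0 le_rfl le_rfl zero_le_one)
  have hfin : ∀ t ∈ Ioc (0 : ℝ) 1, ∃ a < t, 0 ≤ a ∧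
      (S.timeSeparation (γ a) (γ t)).toENNReal < ⊤ := by
    intro t ht
    obtain ⟨a, hat, ha0, ha⟩ := ContinuousSpacetime.exists_left_interval hγ ht
      (ContinuousSpacetime.eventually_toENNReal_lt_top hS (γ t))
    exact ⟨a, hat, ha0, ha a ⟨le_rfl, hat.le⟩ t ⟨hat.le, le_rfl⟩ (hγ.causal a t ha0 hat.le ht.2)⟩
  have hdiff : ∀ᵐ t ∂(volume.restrict (Icc (0 : ℝ) 1)), t ∈ Ioo (0 : ℝ) 1 ∧
      MDifferentiableAt 𝓘(ℝ, ℝ) (𝓡 (d + 1)) γ t := by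
    have h1 := ContinuousSpacetime.ae_mdifferentiableAt hS hγ
    rw [← restrict_Ioo_eq_restrict_Icc] at h1 ⊢
    filter_upwards [h1, ae_restrict_mem measurableSet_Ioo] with t ht1 ht2
    exact ⟨ht2, ht1⟩
  have hlim := hdiff.mono fun t ht =>
    (ContinuousSpacetime.tendsto_timeSeparation_div hS hγ ht.1 ht.2).2
  refine ⟨?_, ?_, ?_⟩
  · rw [hmeas, speedMinorants_eq hγ]
    exact greatestMinorant_isGreatest hL
  · rw [hmeas]
    have := sigmaFinite_greatestMinorant hL h0 hfin
    infer_instance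
  · filter_upwards [hdiff, rnDeriv_greatestMinorant hL h0 hfin hlim] with t ht1 ht2
    rw [velocity_eq_curveVelocity ht1.1]
    refine ⟨ht1.2.mdifferentiableWithinAt,
      (ContinuousSpacetime.tendsto_timeSeparation_div hS hγ ht1.1 ht1.2).1, ?_⟩
    unfold causalSpeed
    rw [hmeas, ht2]
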